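/- Fix an integer $r\ge 1$ and a probability distribution $\mu=(\mu_1,\dots,\mu_r)$ with all $\mu_i>0$. For each $n$ let $K_{1,n},\dots,K_{r,n},P_n$ be nonnegative integers and $\alpha_n\in(0,1)$, with $1\le K_{1,n}\le K_{2,n}\le\dots\le K_{r,n}\le P_n/2$ for all $n\ge 2$, and put $\Theta_n=(K_{1,n},\dots,K_{r,n},P_n,\alpha_n)$. The random graph $\mathbb G(n;\mu,\Theta_n)$ on the nodes $v_1,\dots,v_n$ is defined as follows. The nodes independently receive a class, class $i$ with probability $\mu_i$, and a node of class $i$ independently receives a uniformly random $K_{i,n}$-element subset (its key ring) of a pool of $P_n$ keys. Independently of this, each pair of distinct nodes has a channel that is on with probability $\alpha_n$, independently over pairs. Two distinct nodes are adjacent if and only if their key rings intersect and the channel between them is on. Let $$p_{ij}(n)=1-\binom{P_n-K_{i,n}}{K_{j,n}}\Big/\binom{P_n}{K_{j,n}}\ \text{ if } K_{i,n}+K_{j,n}\le P_n,\qquad p_{ij}(n)=1\ \text{ otherwise},$$ be the probability that the key rings of a class-$i$ node and of a class-$j$ node intersect, and let $\lambda_1(n)=\sum_{j=1}^r\mu_j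 p_{1j}(n)$ and $\Lambda_1(n)=\alpha_n\lambda_1(n)$. Theorem. Assume that, for some $c>0$ and as $n\to\infty$, $\Lambda_1(n)\sim c\,\frac{\log n}{n}$; that, for some $\sigma>0$, $P_n\ge\sigma n$ for all $n\ge1$; and that $p_{11}(n)=\omega\!\left(\frac1{n\alpha_n}\right)$, i.e. $\frac{1}{n\alpha_n}=o(p_{11}(n))$. Then $$\lim_{n\to\infty}\mathbb P[\mathbb G(n;\mu,\Theta_n)\text{ is connected}]=\begin{cases}0&\text{if }c<1,\\ 1&\text{if }c>1,\end{cases}$$ and the probability that $\mathbb G(n;\mu,\Theta_n)$ has no isolated node has the same limits, $0$ if $c<1$ and $1$ if $c>1$. -/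

import Mathlib

open Filter Asymptotics MeasureTheory ProbabilityTheory
open scoped Topology

noncomputable section

namespace HeterogeneousKeyGraph

/-- A scaling of the parameters with `r ≥ 1` classes (class `i` is `i : Fin r`; the class of nodes
with the smallest key rings is `0`): key ring sizes `K n i`, key pool sizes `P n` and channel
probabilities `α n ∈ (0, 1)`, with `1 ≤ K₁ ≤ ⋯ ≤ K_r ≤ P / 2` for all `n ≥ 2`. -/
structure Scaling (r : ℕ) [NeZero r] where
  K : ℕ → Fin r → ℕ
  P : ℕ → ℕ
  α : ℕ → unitInterval
  α_pos : ∀ n, 0 < (α n : ℝ)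
  α_lt_one : ∀ n, (α n : ℝ) < 1
  one_le_K : ∀ n, 2 ≤ n → 1 ≤ K n 0
  K_mono : ∀ n, 2 ≤ n → Monotone (K n)
  K_le : ∀ n, 2 ≤ n → ∀ i, (K n i : ℝ) ≤ (P n : ℝ) / 2

/-- The probability that two independent uniformly random subsets of a pool of `P` keys, of sizes
`k` and `l`, have a key in common. -/
def shareProb (P k l : ℕ) : ℝ :=
  if k + l ≤ P then 1 - ((P - k).choose l : ℝ) / (P.choose l : ℝ) else 1

/-- The law of the pair (class, key ring) of one node: the class is `i` with probability `μ i`,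
and given class `i` the key ring is uniform among the `K i`-element subsets of the key pool. -/
def nodeLaw {r : ℕ} (μ : Fin r → ℝ) (K : Fin r → ℕ) (P : ℕ) :
    Measure (Fin r × Finset (Fin P)) :=
  ∑ i, ENNReal.ofReal (μ i) •
    (Measure.dirac i).prod (uniformOn {S : Finset (Fin P) | S.card = K i})

/-- The sample space: a class and a key ring for each of the `n` nodes, and the graph of the
channels that are on. -/
abbrev Sample (n r P : ℕ) : Type :=
  (Fin n → Fin r × Finset (Fin P)) × SimpleGraph (Fin n)

/-- Nodes are independent with law `nodeLaw`; independently of them, each channel is on with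
probability `α`, independently of all other channels (the Erdős–Rényi graph). -/
def modelMeasure (n : ℕ) {r : ℕ} (μ : Fin r → ℝ) (K : Fin r → ℕ) (P : ℕ) (α : unitInterval) :
    Measure (Sample n r P) :=
  (Measure.pi fun _ : Fin n => nodeLaw μ K P).prod (SimpleGraph.binomialRandom (Fin n) α)

/-- The key graph: distinct nodes are adjacent when their key rings intersect. -/
def keyGraph {n r P : ℕ} (x : Fin n → Fin r × Finset (Fin P)) : SimpleGraph (Fin n) where
  Adj u v := u ≠ v ∧ ((x u).2 ∩ (x v).2).Nonempty
  symm := ⟨fun _ _ h => ⟨h.1.symm, by rw [Finset.inter_comm]; exact h.2⟩⟩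
  loopless := ⟨fun _ h => h.1 rfl⟩

/-- The network: the intersection of the key graph and the graph of the channels. -/
def network {n r P : ℕ} (ω : Sample n r P) : SimpleGraph (Fin n) :=
  keyGraph ω.1 ⊓ ω.2

namespace Scaling

variable {r : ℕ} [NeZero r]

/-- The key sharing probability `p_{ij}(n)` of a class-`i` and a class-`j` node. -/
def p (Θ : Scaling r) (n : ℕ) (i j : Fin r) : ℝ :=
  shareProb (Θ.P n) (Θ.K n i) (Θ.K n j)

/-- The mean key sharing probability `λ_i(n)` of a class-`i` node. -/
def meanShare (Θ : Scaling r) (μ : Fin r → ℝ) (n : ℕ) (i : Fin r) : ℝ :=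
  ∑ j, μ j * Θ.p n i j

/-- The mean edge probability `Λ_i(n) = α_n λ_i(n)` of a class-`i` node. -/
def meanEdge (Θ : Scaling r) (μ : Fin r → ℝ) (n : ℕ) (i : Fin r) : ℝ :=
  (Θ.α n : ℝ) * Θ.meanShare μ n i

/-- The probability that the random network on `n` nodes has the property `A`. -/
def prob (Θ : Scaling r) (μ : Fin r → ℝ) (n : ℕ) (A : SimpleGraph (Fin n) → Prop) : ℝ :=
  (modelMeasure n μ (Θ.K n) (Θ.P n) (Θ.α n)).real {ω | A (network ω)}

end Scaling

end HeterogeneousKeyGraph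

end

/-!
Fix a set `S` of nodes and reveal their key rings one by one, following the probability, as a
function of its key ring, that a further node has no edge to the nodes revealed so far. A new ring
lowers the average of this function by about the edge probability, unless it captures too little of
it, which is unlikely because the smallest key rings grow. Hence with overwhelming probability a
node outside `S` misses all of `S` with probability about `1 - |S| Λ` while `|S| Λ` is small, and at
most a small constant once `|S|` is of order `n`; given the key rings in `S`, the nodes outside `S`
do so independently.

If the graph is not connected, then either some set `S` with `|S| ≤ η n` has no edge to its
complement, or some set of size at least `η n` has no edge to linearly many nodes of a class `j`
with `p₁ⱼ ≥ λ₁`. Union bounds over these sets show that both are unlikely if `c > 1`. If `c < 1`,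
then the second moment method applies to the number of isolated nodes of the first class.
-/

noncomputable section

namespace HeterogeneousKeyGraph

/-! ### Random key rings -/

section SubsetLaw

/-- The law of a uniformly random `k`-element subset of the finite type `β`, the key ring of a node
with `k` keys from the pool `β`; it is the zero measure when `β` has fewer than `k` elements. -/
def subsetLaw (β : Type*) (k : ℕ) : Measure (Finset β) :=
  uniformOn {S | S.card = k}

variable {β : Type*} {k l : ℕ}

instance : IsFiniteMeasure (subsetLaw β k) := by
  unfold subsetLaw uniformOn; infer_instance

theorem ae_card_eq_subsetLaw [Finite β] : ∀ᵐ S ∂subsetLaw β k, S.card = k := by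
  rw [ae_iff, subsetLaw, uniformOn_eq_zero_iff (Set.toFinite _)]
  ext; simp

variable [Fintype β]

theorem isProbabilityMeasure_subsetLaw (hk : k ≤ Fintype.card β) :
    IsProbabilityMeasure (subsetLaw β k) := by
  obtain ⟨S, -, hS⟩ := Finset.exists_subset_card_eq (s := (Finset.univ : Finset β)) hk
  exact isProbabilityMeasure_uniformOn (Set.toFinite _) ⟨S, hS⟩

theorem measureReal_subsetLaw (p : Finset β → Prop) [DecidablePred p] :
    (subsetLaw β k).real {S | p S} =
      ((Finset.powersetCard k Finset.univ).filter p).card / (Fintype.card β).choose k := by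
  classical
  have hs : {S : Finset β | S.card = k} =
      ((Finset.powersetCard k Finset.univ : Finset (Finset β)) : Set (Finset β)) := by
    ext; simp
  have ht : {S : Finset β | p S} = ((Finset.univ.filter p : Finset (Finset β)) : Set _) := by
    ext; simp
  rw [subsetLaw, measureReal_def, hs, ht, uniformOn_apply_finset, Finset.card_powersetCard,
    Finset.card_univ, ENNReal.toReal_div, ENNReal.toReal_natCast, ENNReal.toReal_natCast]
  congr 3
  ext; simp

theorem integral_ite_one_zero {Ω : Type*} [MeasurableSpace Ω] [DiscreteMeasurableSpace Ω]
    (M : Measure Ω) (p : Ω → Prop) [DecidablePred p] :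
    ∫ ω, (if p ω then (1 : ℝ) else 0) ∂M = M.real {ω | p ω} := by
  rw [← integral_indicator_one (MeasurableSet.of_discrete : MeasurableSet {ω | p ω})]
  simp [Set.indicator_apply]

theorem descFactorial_mul_pow_le {k n : ℕ} (hk : k ≤ n) (a : ℕ) :
    k.descFactorial a * n ^ a ≤ n.descFactorial a * k ^ a := by
  induction a with
  | zero => simp
  | succ a ih =>
    have hstep : (k - a) * n ≤ (n - a) * k := by
      rw [Nat.sub_mul, Nat.sub_mul, mul_comm n k]
      exact Nat.sub_le_sub_left (Nat.mul_le_mul_left a hk) _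
    calc k.descFactorial (a + 1) * n ^ (a + 1)
        = (k - a) * n * (k.descFactorial a * n ^ a) := by rw [Nat.descFactorial_succ]; ring
      _ ≤ (n - a) * k * (n.descFactorial a * k ^ a) := Nat.mul_le_mul hstep ih
      _ = n.descFactorial (a + 1) * k ^ (a + 1) := by rw [Nat.descFactorial_succ]; ring

theorem choose_mul_pow_le {k n : ℕ} (hk : k ≤ n) (a : ℕ) :
    k.choose a * n ^ a ≤ n.choose a * k ^ a := by
  have h := descFactorial_mul_pow_le hk a
  rw [Nat.descFactorial_eq_factorial_mul_choose, Nat.descFactorial_eq_factorial_mul_choose,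
    mul_assoc, mul_assoc] at h
  exact Nat.le_of_mul_le_mul_left h a.factorial_pos

theorem measureReal_superset (hk : k ≤ Fintype.card β) (A : Finset β) :
    (subsetLaw β k).real {S | A ⊆ S} = k.choose A.card / (Fintype.card β).choose A.card := by
  classical
  rw [measureReal_subsetLaw]
  rcases lt_or_ge k A.card with h | h
  · have hempty : (Finset.powersetCard k Finset.univ).filter (A ⊆ ·) = ∅ :=
      Finset.filter_eq_empty_iff.2 fun S hS hAS =>
        ((Finset.card_le_card hAS).trans (Finset.mem_powersetCard_univ.1 hS).le).not_gt h
    rw [hempty, Nat.choose_eq_zero_of_lt h]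
    simp
  · have hA : 0 < (Fintype.card β).choose A.card := Nat.choose_pos (h.trans hk)
    have hk' : 0 < (Fintype.card β).choose k := Nat.choose_pos hk
    rw [Finset.card_filter_powersetCard_subset _ _ _ A.subset_univ h, Finset.card_univ,
      div_eq_div_iff (by positivity) (by positivity)]
    rw [mul_comm, mul_comm (k.choose A.card : ℝ)]
    exact_mod_cast (Nat.choose_mul h).symm

theorem measureReal_superset_le (hk : k ≤ Fintype.card β) (A : Finset β) :
    (subsetLaw β k).real {S | A ⊆ S} ≤ ((k : ℝ) / Fintype.card β) ^ A.card := by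
  have hA : 0 < (Fintype.card β).choose A.card := Nat.choose_pos A.card_le_univ
  rw [measureReal_superset hk, div_pow]
  rcases A.eq_empty_or_nonempty with rfl | ⟨b, -⟩
  · simp
  · have hβ : 0 < Fintype.card β := Fintype.card_pos_iff.2 ⟨b⟩
    rw [div_le_div_iff₀ (by positivity) (by positivity), mul_comm ((k : ℝ) ^ _)]
    exact_mod_cast choose_mul_pow_le hk _

theorem measureReal_mem (hk : k ≤ Fintype.card β) (b : β) :
    (subsetLaw β k).real {S | b ∈ S} = (k : ℝ) / Fintype.card β := by
  simpa using measureReal_superset hk {b}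

theorem measureReal_antitone_of_isLowerSet {β : Type*} [Finite β] {𝒜 : Set (Finset β)}
    (h𝒜 : IsLowerSet 𝒜) (hkl : k ≤ l) :
    (subsetLaw β l).real 𝒜 ≤ (subsetLaw β k).real 𝒜 := by
  classical
  cases nonempty_fintype β
  induction l, hkl using Nat.le_induction with
  | base => exact le_rfl
  | succ l _ ih =>
    refine le_trans ?_ ih
    have hLYM := Finset.local_lubell_yamamoto_meshalkin_inequality_div (𝕜 := ℝ)
      (𝒜 := (Finset.powersetCard (l + 1) (Finset.univ : Finset β)).filter (· ∈ 𝒜)) l.succ_ne_zero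
      fun S hS => Finset.mem_powersetCard_univ.1 (Finset.mem_filter.1 hS).1
    have hshadow : ((Finset.powersetCard (l + 1) Finset.univ).filter (· ∈ 𝒜)).shadow ⊆
        (Finset.powersetCard l (Finset.univ : Finset β)).filter (· ∈ 𝒜) := by
      intro S hS
      obtain ⟨T, hT, b, hb, rfl⟩ := Finset.mem_shadow_iff.1 hS
      rw [Finset.mem_filter, Finset.mem_powersetCard_univ] at hT ⊢
      exact ⟨by rw [Finset.card_erase_of_mem hb, hT.1, Nat.add_sub_cancel],
        h𝒜 (Finset.erase_subset b T) hT.2⟩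
    have hreal := fun m => measureReal_subsetLaw (k := m) (· ∈ 𝒜)
    simp only [Set.ofPred_mem_eq] at hreal
    rw [hreal, hreal]
    refine hLYM.trans ?_
    rw [Nat.succ_sub_one]
    gcongr

theorem integral_ite_mem (hk : k ≤ Fintype.card β) [DecidableEq β] (b : β) :
    ∫ S, (if b ∈ S then (1 : ℝ) else 0) ∂subsetLaw β k = (k : ℝ) / Fintype.card β := by
  rw [integral_ite_one_zero, measureReal_mem hk]

theorem integral_sum_mem (hk : k ≤ Fintype.card β) (w : β → ℝ) :
    ∫ S, ∑ b ∈ S, w b ∂subsetLaw β k = (k : ℝ) / Fintype.card β * ∑ b, w b := by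
  classical
  calc ∫ S, ∑ b ∈ S, w b ∂subsetLaw β k
      = ∫ S, ∑ b, w b * (if b ∈ S then 1 else 0) ∂subsetLaw β k := by simp
    _ = ∑ b, w b * ((k : ℝ) / Fintype.card β) := by
        rw [integral_finsetSum _ fun _ _ => .of_finite]
        simp_rw [integral_const_mul, integral_ite_mem hk]
    _ = (k : ℝ) / Fintype.card β * ∑ b, w b := by rw [← Finset.sum_mul, mul_comm]

theorem measureReal_pair_le (hk : k ≤ Fintype.card β) [DecidableEq β] (b c : β) :
    (subsetLaw β k).real {S | b ∈ S ∧ c ∈ S} ≤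
      (if b = c then (k : ℝ) / Fintype.card β else 0) + ((k : ℝ) / Fintype.card β) ^ 2 := by
  have h := measureReal_superset_le hk {b, c}
  simp only [Finset.insert_subset_iff, Finset.singleton_subset_iff] at h
  refine h.trans ?_
  split_ifs with hbc
  · subst hbc
    simpa using sq_nonneg ((k : ℝ) / Fintype.card β)
  · rw [Finset.card_pair hbc, zero_add]

theorem integral_sq_sum_mem_le (hk : k ≤ Fintype.card β) {w : β → ℝ} (hw : ∀ b, 0 ≤ w b) :
    ∫ S, (∑ b ∈ S, w b) ^ 2 ∂subsetLaw β k ≤ (k : ℝ) / Fintype.card β * ∑ b, w b ^ 2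
      + ((k : ℝ) / Fintype.card β * ∑ b, w b) ^ 2 := by
  classical
  set t := (k : ℝ) / Fintype.card β
  have hexpand : ∀ S : Finset β, (∑ b ∈ S, w b) ^ 2
      = ∑ b, ∑ c, w b * w c * (if b ∈ S ∧ c ∈ S then 1 else 0) := by
    intro S
    simp [sq, Finset.sum_mul_sum, ite_and]
  simp_rw [hexpand]
  rw [integral_finsetSum _ fun _ _ => .of_finite]
  simp_rw [integral_finsetSum _ fun _ _ => Integrable.of_finite, integral_const_mul,
    integral_ite_one_zero]
  calc ∑ b, ∑ c, w b * w c * (subsetLaw β k).real {S | b ∈ S ∧ c ∈ S}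
      ≤ ∑ b, ∑ c, w b * w c * ((if b = c then t else 0) + t ^ 2) := by
        gcongr with b _ c _
        · exact mul_nonneg (hw b) (hw c)
        · exact measureReal_pair_le hk b c
    _ = t * ∑ b, w b ^ 2 + (t * ∑ b, w b) ^ 2 := by
        simp_rw [mul_add, Finset.sum_add_distrib, ← Finset.sum_mul, ← Finset.sum_mul_sum]
        simp only [mul_ite, mul_zero, Finset.sum_ite_eq, Finset.mem_univ, if_true, ← sq]
        rw [← Finset.sum_mul]
        ring

theorem variance_sum_mem_le (hk : k ≤ Fintype.card β) {w : β → ℝ} (hw : ∀ b, 0 ≤ w b) :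
    Var[fun S => ∑ b ∈ S, w b; subsetLaw β k] ≤ (k : ℝ) / Fintype.card β * ∑ b, w b ^ 2 := by
  have := isProbabilityMeasure_subsetLaw hk
  have h := integral_sq_sum_mem_le hk hw
  rw [variance_eq_sub .of_discrete, integral_sum_mem hk]
  simpa using h

theorem integral_card_inter (hk : k ≤ Fintype.card β) [DecidableEq β] (T : Finset β) :
    ∫ S, ((T ∩ S).card : ℝ) ∂subsetLaw β k = (k : ℝ) / Fintype.card β * T.card := by
  have h := integral_sum_mem hk fun b => if b ∈ T then (1 : ℝ) else 0
  simpa [Finset.inter_comm] using h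

theorem integral_sq_card_inter_le (hk : k ≤ Fintype.card β) [DecidableEq β] (T : Finset β) :
    ∫ S, ((T ∩ S).card : ℝ) ^ 2 ∂subsetLaw β k ≤
      (k : ℝ) / Fintype.card β * T.card + ((k : ℝ) / Fintype.card β * T.card) ^ 2 := by
  have h := integral_sq_sum_mem_le hk (w := fun b => if b ∈ T then (1 : ℝ) else 0)
    fun b => by positivity
  simpa [Finset.inter_comm] using h

theorem measureReal_le_card_inter_le_choose (hk : k ≤ Fintype.card β) [DecidableEq β]
    (B : Finset β) (a : ℕ) :
    (subsetLaw β k).real {T | a ≤ (T ∩ B).card} ≤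
      B.card.choose a * ((k : ℝ) / Fintype.card β) ^ a := by
  have hsub : {T : Finset β | a ≤ (T ∩ B).card} ⊆
      ⋃ A ∈ Finset.powersetCard a B, {T | A ⊆ T} := by
    intro T hT
    obtain ⟨A, hA, hcard⟩ := Finset.exists_subset_card_eq hT
    exact Set.mem_biUnion (Finset.mem_powersetCard.2 ⟨hA.trans Finset.inter_subset_right, hcard⟩)
      (hA.trans Finset.inter_subset_left)
  calc (subsetLaw β k).real {T | a ≤ (T ∩ B).card}
      ≤ ∑ A ∈ Finset.powersetCard a B, (subsetLaw β k).real {T | A ⊆ T} :=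
        (measureReal_mono hsub (measure_ne_top _ _)).trans (measureReal_biUnion_finset_le _ _)
    _ ≤ ∑ _ ∈ Finset.powersetCard a B, ((k : ℝ) / Fintype.card β) ^ a := by
        refine Finset.sum_le_sum fun A hA => ?_
        rw [← (Finset.mem_powersetCard.1 hA).2]
        exact measureReal_superset_le hk A
    _ = B.card.choose a * ((k : ℝ) / Fintype.card β) ^ a := by
        rw [Finset.sum_const, Finset.card_powersetCard, nsmul_eq_mul]

theorem choose_mul_pow_le_pow {a m : ℕ} {x y : ℝ} (hx : 0 ≤ x) (h : m * x ≤ y * a) :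
    m.choose a * x ^ a ≤ (3 * y) ^ a := by
  rcases a.eq_zero_or_pos with rfl | ha
  · simp
  have hy : 0 ≤ y := by
    have : (0 : ℝ) < a := by exact_mod_cast ha
    exact nonneg_of_mul_nonneg_left ((by positivity : (0 : ℝ) ≤ m * x).trans h) this
  calc m.choose a * x ^ a ≤ m ^ a / a.factorial * x ^ a := by
        gcongr
        exact Nat.choose_le_pow_div a m
    _ = (m * x) ^ a / a.factorial := by rw [mul_pow]; ring
    _ ≤ (y * a) ^ a / a.factorial := by gcongr
    _ = y ^ a * ((a : ℝ) ^ a / a.factorial) := by rw [mul_pow]; ring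
    _ ≤ y ^ a * Real.exp a := by
        gcongr
        exact Real.pow_div_factorial_le_exp _ (Nat.cast_nonneg a) a
    _ = (Real.exp 1 * y) ^ a := by rw [mul_pow, ← Real.exp_nat_mul, mul_one, mul_comm]
    _ ≤ (3 * y) ^ a := by
        gcongr
        exact Real.exp_one_lt_three.le

theorem measureReal_le_card_inter_le_pow (hk : k ≤ Fintype.card β) [DecidableEq β] {B : Finset β}
    {a : ℕ} {y : ℝ} (h : B.card * ((k : ℝ) / Fintype.card β) ≤ y * a) :
    (subsetLaw β k).real {T | a ≤ (T ∩ B).card} ≤ (3 * y) ^ a :=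
  (measureReal_le_card_inter_le_choose hk B a).trans (choose_mul_pow_le_pow (by positivity) h)

end SubsetLaw

section Hit

variable {β : Type*} [DecidableEq β]

/-- The indicator that the key rings `S` and `T` have a key in common. -/
def hit (S T : Finset β) : ℝ := if Disjoint S T then 0 else 1

theorem hit_nonneg (S T : Finset β) : 0 ≤ hit S T := by
  unfold hit; split_ifs <;> norm_num

theorem hit_le_one (S T : Finset β) : hit S T ≤ 1 := by
  unfold hit; split_ifs <;> norm_num

theorem hit_comm (S T : Finset β) : hit S T = hit T S := by
  simp only [hit, disjoint_comm]

theorem hit_mono_left {S S' : Finset β} (h : S ⊆ S') (T : Finset β) : hit S T ≤ hit S' T := by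
  by_cases hd : Disjoint S' T
  · simp [hit, hd, hd.mono_left h]
  · simpa [hit, hd] using hit_le_one S T

theorem hit_le_card_inter (S T : Finset β) : hit S T ≤ (S ∩ T).card := by
  unfold hit
  split_ifs with h
  · positivity
  · exact_mod_cast Finset.card_pos.2 (Finset.not_disjoint_iff_nonempty_inter.1 h)

/-- From `(1 - t X) ^ 2 ≥ 0` with `X` the number of common keys. -/
theorem le_hit (S T : Finset β) (t : ℝ) :
    2 * t * (S ∩ T).card - t ^ 2 * ((S ∩ T).card : ℝ) ^ 2 ≤ hit S T := by
  unfold hit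
  split_ifs with h
  · simp [Finset.disjoint_iff_inter_eq_empty.1 h]
  · linarith [sq_nonneg (1 - t * (S ∩ T).card)]

end Hit

section ShareProb

variable {β : Type*} [Fintype β] [DecidableEq β] {P k l : ℕ}

theorem integral_hit (T : Finset β) (h : T.card + k ≤ Fintype.card β) :
    ∫ S, hit T S ∂subsetLaw β k = shareProb (Fintype.card β) T.card k := by
  have := isProbabilityMeasure_subsetLaw (β := β) (le_of_add_le_right h)
  have hhit : ∀ S, hit T S = 1 - if S ⊆ Tᶜ then 1 else 0 := fun S => by
    simp only [hit, Finset.subset_compl_iff_disjoint_left]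
    split_ifs <;> norm_num
  have hfilter : (Finset.powersetCard k Finset.univ).filter (· ⊆ Tᶜ) =
      Finset.powersetCard k Tᶜ := by
    ext S; simp [Finset.mem_powersetCard, and_comm]
  simp_rw [hhit]
  rw [integral_sub .of_finite .of_finite, integral_ite_one_zero, measureReal_subsetLaw, hfilter,
    Finset.card_powersetCard, Finset.card_compl, shareProb, if_pos h]
  simp

theorem shareProb_eq_integral (h : k + l ≤ P) :
    ∃ T : Finset (Fin P), T.card = k ∧ ∫ S, hit T S ∂subsetLaw (Fin P) l = shareProb P k l := by
  obtain ⟨T, -, hT⟩ := Finset.exists_subset_card_eq (s := (Finset.univ : Finset (Fin P))) (n := k)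
    (by simpa using le_of_add_le_left h)
  have := integral_hit T (k := l) (by simpa [hT] using h)
  rw [Fintype.card_fin, hT] at this
  exact ⟨T, hT, this⟩

theorem shareProb_nonneg (h : k + l ≤ P) : 0 ≤ shareProb P k l := by
  obtain ⟨T, -, hT⟩ := shareProb_eq_integral h
  exact hT ▸ integral_nonneg fun S => hit_nonneg T S

theorem shareProb_le_one (h : k + l ≤ P) : shareProb P k l ≤ 1 := by
  obtain ⟨T, -, hT⟩ := shareProb_eq_integral h
  have := isProbabilityMeasure_subsetLaw (β := Fin P) (k := l)
    (by simpa using le_of_add_le_right h)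
  simpa [hT] using integral_mono (μ := subsetLaw (Fin P) l) .of_finite .of_finite (hit_le_one T)

theorem shareProb_le (h : k + l ≤ P) : shareProb P k l ≤ (l : ℝ) / P * k := by
  obtain ⟨T, hTk, hT⟩ := shareProb_eq_integral h
  have hcard := integral_card_inter (β := Fin P) (by simpa using le_of_add_le_right h) T
  rw [Fintype.card_fin, hTk] at hcard
  rw [← hT, ← hcard]
  exact integral_mono .of_finite .of_finite (hit_le_card_inter T)

theorem le_shareProb (h : k + l ≤ P) :
    (l : ℝ) / P * k / (1 + (l : ℝ) / P * k) ≤ shareProb P k l := by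
  obtain ⟨T, hTk, hT⟩ := shareProb_eq_integral h
  have hl : l ≤ Fintype.card (Fin P) := by simpa using le_of_add_le_right h
  set z := (l : ℝ) / P * k
  have hz : 0 ≤ z := by positivity
  have hfst := integral_card_inter hl T
  have hsnd := integral_sq_card_inter_le hl T
  rw [Fintype.card_fin, hTk] at hfst hsnd
  set t := 1 / (1 + z)
  calc z / (1 + z) = 2 * t * z - t ^ 2 * (z + z ^ 2) := by simp only [t]; field_simp; ring
    _ ≤ 2 * t * ∫ S, ((T ∩ S).card : ℝ) ∂subsetLaw (Fin P) l
        - t ^ 2 * ∫ S, ((T ∩ S).card : ℝ) ^ 2 ∂subsetLaw (Fin P) l := by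
        rw [hfst]; gcongr
    _ = ∫ S, (2 * t * (T ∩ S).card - t ^ 2 * ((T ∩ S).card : ℝ) ^ 2) ∂subsetLaw (Fin P) l := by
        rw [integral_sub .of_finite .of_finite, integral_const_mul, integral_const_mul]
    _ ≤ ∫ S, hit T S ∂subsetLaw (Fin P) l :=
        integral_mono .of_finite .of_finite fun S => le_hit T S t
    _ = shareProb P k l := hT

end ShareProb

section Load

variable {β : Type*} [DecidableEq β] {k : ℕ} {g : Finset β → ℝ}

/-- The mass which the weight `g` on the `k`-element key rings puts on the rings containing the
key `b`. -/
def load (k : ℕ) (g : Finset β → ℝ) (b : β) : ℝ :=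
  ∫ S, g S * (if b ∈ S then 1 else 0) ∂subsetLaw β k

theorem load_nonneg (hg : ∀ S, 0 ≤ g S) (b : β) : 0 ≤ load k g b :=
  integral_nonneg fun S => mul_nonneg (hg S) (by positivity)

section Finite

variable [Finite β]

theorem sum_mem_load (T : Finset β) :
    ∑ b ∈ T, load k g b = ∫ S, g S * (T ∩ S).card ∂subsetLaw β k := by
  simp_rw [load, ← integral_finsetSum T fun _ _ => Integrable.of_finite (μ := subsetLaw β k),
    ← Finset.mul_sum]
  simp

theorem integral_mul_hit_le_sum_load (hg : ∀ S, 0 ≤ g S) (T : Finset β) :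
    ∫ S, g S * hit T S ∂subsetLaw β k ≤ ∑ b ∈ T, load k g b := by
  rw [sum_mem_load]
  exact integral_mono .of_finite .of_finite fun S =>
    mul_le_mul_of_nonneg_left (hit_le_card_inter T S) (hg S)

theorem isLowerSet_integral_mul_hit_lt (hg : ∀ S, 0 ≤ g S) (y : ℝ) :
    IsLowerSet {T | ∫ S, g S * hit T S ∂subsetLaw β k < y} := fun _ _ hT' hT =>
  lt_of_le_of_lt (integral_mono .of_finite .of_finite fun S =>
    mul_le_mul_of_nonneg_left (hit_mono_left hT' S) (hg S)) hT

end Finite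

variable [Fintype β]

theorem load_le (hk : k ≤ Fintype.card β) (hg : ∀ S, g S ≤ 1) (b : β) :
    load k g b ≤ (k : ℝ) / Fintype.card β := by
  rw [← integral_ite_mem hk b]
  exact integral_mono .of_finite .of_finite fun S => mul_le_of_le_one_left (by positivity) (hg S)

theorem sum_load : ∑ b, load k g b = k * ∫ S, g S ∂subsetLaw β k := by
  rw [sum_mem_load, ← integral_const_mul]
  refine integral_congr_ae ?_
  filter_upwards [ae_card_eq_subsetLaw] with S hS
  rw [Finset.univ_inter, hS, mul_comm]

end Load

section LowLoss

variable {β : Type*} [Fintype β] [DecidableEq β] {k : ℕ} {f : Finset β → ℝ} {q : ℝ}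

/-- The keys whose load under `f` exceeds the fraction `1 / q` of the maximal load `k / |β|`. -/
def heavyKeys (k : ℕ) (f : Finset β → ℝ) (q : ℝ) : Finset β :=
  Finset.univ.filter fun b => (k : ℝ) / Fintype.card β / q < load k f b

theorem card_heavyKeys_mul_le (hf : ∀ S, 0 ≤ f S) (hq : 0 < q) :
    (heavyKeys k f q).card * ((k : ℝ) / Fintype.card β) ≤
      q * (k * ∫ S, f S ∂subsetLaw β k) := by
  rw [← sum_load, mul_comm q, ← div_le_iff₀ hq, mul_div_assoc, ← nsmul_eq_mul]
  calc (heavyKeys k f q).card • ((k : ℝ) / Fintype.card β / q)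
      ≤ ∑ b ∈ heavyKeys k f q, load k f b :=
        Finset.card_nsmul_le_sum _ _ _ fun b hb => (Finset.mem_filter.1 hb).2.le
    _ ≤ ∑ b, load k f b :=
        Finset.sum_le_univ_sum_of_nonneg fun b => load_nonneg hf b

theorem sum_load_le (hk : k ≤ Fintype.card β) (hf : ∀ S, f S ≤ 1) (hq : 0 < q) (T : Finset β) :
    ∑ b ∈ T, load k f b ≤
      (k : ℝ) / Fintype.card β * ((T ∩ heavyKeys k f q).card + T.card / q) := by
  have hload : ∀ b, load k f b ≤
      (k : ℝ) / Fintype.card β * ((if b ∈ heavyKeys k f q then 1 else 0) + 1 / q) := by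
    intro b
    split_ifs with hb
    · refine (load_le hk hf b).trans (le_mul_of_one_le_right (by positivity) ?_)
      have : 0 < 1 / q := by positivity
      linarith
    · rw [zero_add, mul_one_div]
      simpa [heavyKeys] using hb
  refine (Finset.sum_le_sum fun b _ => hload b).trans_eq ?_
  rw [← Finset.mul_sum, Finset.sum_add_distrib]
  simp [div_eq_mul_inv]

/-- Together the two bounds `z / (1 + z) ≤ p` and `loss ≤ min (2 z / q) (2 / q)` show that the
loss is a small proportion of `p`. -/
theorem integral_mul_hit_le_mul_shareProb {T : Finset β} (h : T.card + k ≤ Fintype.card β)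
    (hf0 : ∀ S, 0 ≤ f S) (hf1 : ∀ S, f S ≤ 1) (hq : 0 < q)
    (hmean : ∫ S, f S ∂subsetLaw β k ≤ 2 / q) (hT : ((T ∩ heavyKeys k f q).card : ℝ) ≤ T.card / q) :
    ∫ S, f S * hit T S ∂subsetLaw β k ≤ 4 / q * shareProb (Fintype.card β) T.card k := by
  set z := (k : ℝ) / Fintype.card β * T.card with hz
  have hz0 : 0 ≤ z := by positivity
  set loss := ∫ S, f S * hit T S ∂subsetLaw β k
  have hloss1 : loss ≤ 2 / q := (integral_mono .of_finite .of_finite fun S =>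
    mul_le_of_le_one_right (hf0 S) (hit_le_one T S)).trans hmean
  have hloss2 : loss ≤ 2 / q * z := by
    refine ((integral_mul_hit_le_sum_load hf0 T).trans
      (sum_load_le (le_of_add_le_right h) hf1 hq T)).trans ?_
    calc (k : ℝ) / Fintype.card β * ((T ∩ heavyKeys k f q).card + T.card / q)
        ≤ (k : ℝ) / Fintype.card β * (T.card / q + T.card / q) := by gcongr
      _ = 2 / q * z := by rw [hz]; ring
  calc loss ≤ 4 / q * (z / (1 + z)) := by
        rw [← mul_div_assoc, le_div_iff₀ (by positivity)]
        calc loss * (1 + z) = loss + loss * z := by ring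
          _ ≤ 2 / q * z + 2 / q * z := by gcongr
          _ = 4 / q * z := by ring
    _ ≤ 4 / q * shareProb (Fintype.card β) T.card k := by
        gcongr
        exact le_shareProb h

end LowLoss

section OneStep

variable {β : Type*} [Fintype β] [DecidableEq β] {K k l : ℕ} {g : Finset β → ℝ}

theorem measureReal_le_card_inter_heavyKeys_le_pow {f : Finset β → ℝ} (hK : K ≤ Fintype.card β)
    (hk : 0 < k) (hf : ∀ S, 0 ≤ f S) {q x : ℝ} {L : ℕ} (hq : 0 < q) (hL : q * L ≤ K)
    (hx : ∫ S, f S ∂subsetLaw β k ≤ x) (hqx : 3 * (q ^ 2 * x) ≤ 1) :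
    (subsetLaw β K).real {T | ⌈(K : ℝ) / q⌉₊ ≤ (T ∩ heavyKeys k f q).card} ≤
      (3 * (q ^ 2 * x)) ^ L := by
  have hx0 : 0 ≤ x := (integral_nonneg hf).trans hx
  set a := ⌈(K : ℝ) / q⌉₊
  have hLa : L ≤ a := Nat.cast_le.1 (((le_div_iff₀' hq).2 hL).trans (Nat.le_ceil _))
  have hheavy : (heavyKeys k f q).card * ((K : ℝ) / Fintype.card β) ≤ q ^ 2 * x * a := by
    have hcard : (heavyKeys k f q).card * ((k : ℝ) / Fintype.card β) ≤ q * (k * x) :=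
      (card_heavyKeys_mul_le hf hq).trans (by gcongr)
    have hk0 : (0 : ℝ) < k := by exact_mod_cast hk
    have hKa : (K : ℝ) / k ≤ q * a / k := by
      gcongr
      exact (div_le_iff₀' hq).1 (Nat.le_ceil _)
    calc (heavyKeys k f q).card * ((K : ℝ) / Fintype.card β)
        = (heavyKeys k f q).card * ((k : ℝ) / Fintype.card β) * (K / k) := by field_simp
      _ ≤ q * (k * x) * (q * a / k) := by gcongr
      _ = q ^ 2 * x * a := by field_simp
  exact (measureReal_le_card_inter_le_pow hK hheavy).trans
    (pow_le_pow_of_le_one (by positivity) hqx hLa)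

/-- A ring that captures noticeably less than its share of `g` contains many of the few keys that
are heavy for `1 - g`. -/
theorem measureReal_integral_mul_hit_lt_le_pow (h : K + k ≤ Fintype.card β) (hk : 0 < k)
    (hKl : K ≤ l) (hg0 : ∀ S, 0 ≤ g S) (hg1 : ∀ S, g S ≤ 1) {q x : ℝ} {L : ℕ} (hq : 1 ≤ q)
    (hL : q * L ≤ K) (hx : 1 - x ≤ ∫ S, g S ∂subsetLaw β k) (hqx : 3 * (q ^ 2 * x) ≤ 1) :
    (subsetLaw β l).real {T | ∫ S, g S * hit T S ∂subsetLaw β k <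
      (1 - 4 / q) * shareProb (Fintype.card β) K k} ≤ (3 * (q ^ 2 * x)) ^ L := by
  have := isProbabilityMeasure_subsetLaw (β := β) (le_of_add_le_right h)
  have hq0 : 0 < q := by linarith
  set f : Finset β → ℝ := fun S => 1 - g S with hf
  have hf0 : ∀ S, 0 ≤ f S := fun S => sub_nonneg.2 (hg1 S)
  have hf1 : ∀ S, f S ≤ 1 := fun S => sub_le_self 1 (hg0 S)
  have hmean : ∫ S, f S ∂subsetLaw β k ≤ x := by
    simp_rw [hf, integral_sub (μ := subsetLaw β k) .of_finite .of_finite, integral_const,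
      probReal_univ, one_smul]
    linarith
  have hx2 : x ≤ 2 / q := by
    rw [le_div_iff₀ hq0]
    nlinarith [(integral_nonneg hf0).trans hmean]
  have hsub : ∀ᵐ T ∂subsetLaw β K, ∫ S, g S * hit T S ∂subsetLaw β k <
      (1 - 4 / q) * shareProb (Fintype.card β) K k →
      ⌈(K : ℝ) / q⌉₊ ≤ (T ∩ heavyKeys k f q).card := by
    filter_upwards [ae_card_eq_subsetLaw] with T hT
    contrapose!
    intro hlt
    have hloss := integral_mul_hit_le_mul_shareProb (q := q) (by rwa [hT]) hf0 hf1 hq0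
      (hmean.trans hx2) (by rw [hT]; exact (Nat.lt_ceil.1 hlt).le)
    simp_rw [hf, sub_mul, one_mul] at hloss
    rw [integral_sub .of_finite .of_finite, integral_hit T (by rwa [hT]), hT] at hloss
    linarith
  calc _ ≤ (subsetLaw β K).real {T | ∫ S, g S * hit T S ∂subsetLaw β k <
        (1 - 4 / q) * shareProb (Fintype.card β) K k} :=
        measureReal_antitone_of_isLowerSet (isLowerSet_integral_mul_hit_lt hg0 _) hKl
    _ ≤ (subsetLaw β K).real {T | ⌈(K : ℝ) / q⌉₊ ≤ (T ∩ heavyKeys k f q).card} :=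
        ENNReal.toReal_mono (measure_ne_top _ _) (measure_mono_ae hsub)
    _ ≤ (3 * (q ^ 2 * x)) ^ L :=
        measureReal_le_card_inter_heavyKeys_le_pow (le_of_add_le_left h) hk hf0 hq0 hL hmean hqx

/-- The choice `t = d / (2 (1 + z))` in `2 t X - t ^ 2 X ^ 2 ≤ hit`. -/
theorem le_integral_mul_hit {T : Finset β} (h : T.card + k ≤ Fintype.card β)
    (hg0 : ∀ S, 0 ≤ g S) (hg1 : ∀ S, g S ≤ 1) {d : ℝ} (hd : 0 ≤ d)
    (hT : (k : ℝ) / Fintype.card β * T.card * d / 2 ≤ ∑ b ∈ T, load k g b) :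
    d ^ 2 / 8 * shareProb (Fintype.card β) T.card k ≤ ∫ S, g S * hit T S ∂subsetLaw β k := by
  set z := (k : ℝ) / Fintype.card β * T.card
  have hz0 : 0 ≤ z := by positivity
  set t := d / (2 * (1 + z))
  have ht : 0 ≤ t := by positivity
  have hshare : shareProb (Fintype.card β) T.card k ≤ 2 * (z / (1 + z)) := by
    rw [← mul_div_assoc, le_div_iff₀ (by positivity)]
    nlinarith [shareProb_le h, shareProb_le_one h]
  have hsnd : ∫ S, g S * ((T ∩ S).card : ℝ) ^ 2 ∂subsetLaw β k ≤ z + z ^ 2 :=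
    (integral_mono .of_finite .of_finite fun S => mul_le_of_le_one_left (by positivity)
      (hg1 S)).trans (integral_sq_card_inter_le (le_of_add_le_right h) T)
  calc d ^ 2 / 8 * shareProb (Fintype.card β) T.card k ≤ d ^ 2 / 8 * (2 * (z / (1 + z))) := by
        gcongr
    _ = 2 * t * (z * d / 2) - t ^ 2 * (z + z ^ 2) := by simp only [t]; field_simp; ring
    _ ≤ 2 * t * ∑ b ∈ T, load k g b
        - t ^ 2 * ∫ S, g S * ((T ∩ S).card : ℝ) ^ 2 ∂subsetLaw β k := by gcongr
    _ = ∫ S, g S * (2 * t * (T ∩ S).card - t ^ 2 * ((T ∩ S).card : ℝ) ^ 2) ∂subsetLaw β k := by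
        rw [sum_mem_load, ← integral_const_mul, ← integral_const_mul,
          ← integral_sub .of_finite .of_finite]
        exact integral_congr_ae (.of_forall fun S => by ring)
    _ ≤ ∫ S, g S * hit T S ∂subsetLaw β k := integral_mono .of_finite .of_finite fun S =>
        mul_le_mul_of_nonneg_left (le_hit T S t) (hg0 S)

theorem variance_sum_load_le (hK : K ≤ Fintype.card β) (hk : k ≤ Fintype.card β)
    (hg0 : ∀ S, 0 ≤ g S) (hg1 : ∀ S, g S ≤ 1) :
    Var[fun T => ∑ b ∈ T, load k g b; subsetLaw β K] ≤ K * ((k : ℝ) / Fintype.card β) ^ 2 := by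
  refine (variance_sum_mem_le hK (load_nonneg hg0)).trans ?_
  calc (K : ℝ) / Fintype.card β * ∑ b, load k g b ^ 2
      ≤ (K : ℝ) / Fintype.card β * ∑ _b : β, ((k : ℝ) / Fintype.card β) ^ 2 := by
        gcongr with b
        · exact load_nonneg hg0 b
        · exact load_le hk hg1 b
    _ = K / Fintype.card β * Fintype.card β * ((k : ℝ) / Fintype.card β) ^ 2 := by
        rw [Finset.sum_const, Finset.card_univ, nsmul_eq_mul, mul_assoc]
    _ ≤ K * ((k : ℝ) / Fintype.card β) ^ 2 := by
        gcongr
        exact (div_mul_eq_mul_div _ _ _).trans_le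
          (div_le_of_le_mul₀ (by positivity) (by positivity) le_rfl)

/-- Chebyshev's inequality for the total load of the ring under `g`. -/
theorem measureReal_integral_mul_hit_lt_le (h : K + k ≤ Fintype.card β) (hK : 0 < K) (hk : 0 < k)
    (hKl : K ≤ l) (hg0 : ∀ S, 0 ≤ g S) (hg1 : ∀ S, g S ≤ 1) {d : ℝ} (hd : 0 < d)
    (hmean : d ≤ ∫ S, g S ∂subsetLaw β k) :
    (subsetLaw β l).real {T | ∫ S, g S * hit T S ∂subsetLaw β k <
      d ^ 2 / 8 * shareProb (Fintype.card β) K k} ≤ 4 / (K * d ^ 2) := by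
  have hKβ : K ≤ Fintype.card β := le_of_add_le_left h
  have := isProbabilityMeasure_subsetLaw hKβ
  set s := (k : ℝ) / Fintype.card β with hsdef
  have hs : 0 < s := by
    have : 0 < Fintype.card β := hK.trans_le hKβ
    positivity
  set X : Finset β → ℝ := fun T => ∑ b ∈ T, load k g b with hX
  have hXmean : s * K * d ≤ ∫ T, X T ∂subsetLaw β K := by
    rw [hX, integral_sum_mem hKβ, sum_load]
    calc s * K * d = K / Fintype.card β * (k * d) := by rw [hsdef]; ring
      _ ≤ _ := by gcongr
  have hsub : ∀ᵐ T ∂subsetLaw β K, ∫ S, g S * hit T S ∂subsetLaw β k <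
      d ^ 2 / 8 * shareProb (Fintype.card β) K k →
      s * K * d / 2 ≤ |X T - ∫ T, X T ∂subsetLaw β K| := by
    filter_upwards [ae_card_eq_subsetLaw] with T hT hlt
    by_contra! hdev
    refine hlt.not_ge ?_
    rw [← hT] at h ⊢
    refine le_integral_mul_hit h hg0 hg1 hd.le ?_
    rw [hT]
    linarith [(abs_lt.1 hdev).1]
  calc _ ≤ (subsetLaw β K).real {T | ∫ S, g S * hit T S ∂subsetLaw β k <
        d ^ 2 / 8 * shareProb (Fintype.card β) K k} :=
        measureReal_antitone_of_isLowerSet (isLowerSet_integral_mul_hit_lt hg0 _) hKl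
    _ ≤ (subsetLaw β K).real {T | s * K * d / 2 ≤ |X T - ∫ T, X T ∂subsetLaw β K|} :=
        ENNReal.toReal_mono (measure_ne_top _ _) (measure_mono_ae hsub)
    _ ≤ Var[X; subsetLaw β K] / (s * K * d / 2) ^ 2 :=
        ENNReal.toReal_le_of_le_ofReal (div_nonneg (variance_nonneg _ _) (sq_nonneg _))
          (meas_ge_le_variance_div_sq .of_discrete (by positivity))
    _ ≤ K * s ^ 2 / (s * K * d / 2) ^ 2 := by
        gcongr
        exact variance_sum_load_le hKβ (le_of_add_le_right h) hg0 hg1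
    _ = 4 / (K * d ^ 2) := by field_simp; norm_num

end OneStep

/-! ### Revealing independent nodes one by one -/

section Product

theorem measureReal_prod {Ω Ω' : Type*} [MeasurableSpace Ω] [MeasurableSpace Ω'] (M : Measure Ω)
    (N : Measure Ω') [IsFiniteMeasure N] {s : Set (Ω × Ω')} (hs : MeasurableSet s) :
    (M.prod N).real s = ∫ ω, N.real {ω' | (ω, ω') ∈ s} ∂M := by
  rw [measureReal_def, Measure.prod_apply hs]
  exact (integral_toReal (measurable_measure_prodMk_left hs).aemeasurable
    (.of_forall fun ω => measure_lt_top N _)).symm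

variable {ι A : Type*} [Fintype ι] [Finite A] [MeasurableSpace A]
  [DiscreteMeasurableSpace A] (ν : Measure A) [IsProbabilityMeasure ν]

theorem integral_pi_mul_prod {S T : Finset ι} (h : Disjoint S T) (Ψ : (S → A) → ℝ)
    (F : (S → A) → A → ℝ) :
    ∫ x : ι → A, Ψ (S.restrict x) * ∏ v ∈ T, F (S.restrict x) (x v) ∂Measure.pi (fun _ => ν) =
      ∫ y : S → A, Ψ y * (∫ a, F y a ∂ν) ^ T.card ∂Measure.pi (fun _ => ν) := by
  classical
  have hunion : (Measure.pi fun _ : ι => ν).map (S ∪ T).restrict =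
      Measure.pi fun _ : ↥(S ∪ T) => ν := by
    rw [← Measure.infinitePi_eq_pi]
    exact Measure.infinitePi_map_restrict _
  let left : (↥(S ∪ T) → A) → S → A :=
    Finset.restrict₂ (π := fun _ => A) Finset.subset_union_left
  let right : (↥(S ∪ T) → A) → T → A :=
    Finset.restrict₂ (π := fun _ => A) Finset.subset_union_right
  let f : (↥(S ∪ T) → A) → ℝ := fun z => Ψ (left z) * ∏ v, F (left z) (right z v)
  calc _ = ∫ x : ι → A, f ((S ∪ T).restrict x) ∂Measure.pi (fun _ => ν) := by
        simp_rw [← Finset.prod_coe_sort T]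
        rfl
    _ = ∫ z, f (MeasurableEquiv.piFinsetUnion (fun _ => A) h z)
          ∂(Measure.pi fun _ : S => ν).prod (Measure.pi fun _ : T => ν) := by
        rw [(measurePreserving_piFinsetUnion h fun _ => ν).integral_comp', ← hunion,
          integral_map (by fun_prop) (by fun_prop)]
    _ = ∫ y : S → A, Ψ y * ∫ w : T → A, ∏ v, F y (w v) ∂Measure.pi (fun _ => ν)
          ∂Measure.pi (fun _ => ν) := by
        rw [integral_prod _ .of_finite]
        simp_rw [← integral_const_mul]
        refine integral_congr_ae (.of_forall fun y => integral_congr_ae (.of_forall fun w => ?_))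
        have hleft : left (MeasurableEquiv.piFinsetUnion (fun _ => A) h (y, w)) = y :=
          funext fun u => Equiv.piFinsetUnion_left (fun _ => A) h u.2 (Finset.mem_union_left T u.2)
        have hright : right (MeasurableEquiv.piFinsetUnion (fun _ => A) h (y, w)) = w :=
          funext fun v =>
            Equiv.piFinsetUnion_right (fun _ => A) h v.2 (Finset.mem_union_right S v.2)
        simp only [f, hleft, hright]
    _ = _ := by
        simp_rw [integral_fintype_prod_eq_pow, Fintype.card_coe]

end Product

section Steps

theorem apply_mul_prod_le {ι A M : Type*} [CommMonoid M] {F : A → M} {V : M → ℝ}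
    (hV : ∀ g a, V (g * F a) ≤ V g) (s : Finset ι) (y : ι → A) (g : M) :
    V (g * ∏ i ∈ s, F (y i)) ≤ V g := by
  classical
  induction s using Finset.induction_on with
  | empty => simp
  | insert i s hi ih =>
    rw [Finset.prod_insert hi, mul_left_comm, mul_comm]
    exact (hV _ _).trans ih

variable {A M : Type*} [Finite A] [MeasurableSpace A] [DiscreteMeasurableSpace A] {ν : Measure A}
  [IsProbabilityMeasure ν]

theorem measureReal_pi_fin_succ_le {m : ℕ} {E : Set (Fin (m + 1) → A)} {B : Set A} {c c' : ℝ}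
    (hB : ∀ a ∈ B, (Measure.pi fun _ : Fin m => ν).real {y | Fin.cons a y ∈ E} ≤ c + c')
    (hBc : ∀ a ∉ B, (Measure.pi fun _ : Fin m => ν).real {y | Fin.cons a y ∈ E} ≤ c) :
    (Measure.pi fun _ : Fin (m + 1) => ν).real E ≤ c + ν.real B * c' := by
  classical
  calc (Measure.pi fun _ : Fin (m + 1) => ν).real E
      = ∫ a, (Measure.pi fun _ : Fin m => ν).real {y | Fin.cons a y ∈ E} ∂ν := by
        rw [← (measurePreserving_piFinSuccAbove (fun _ : Fin (m + 1) => ν)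
          0).symm.measureReal_preimage MeasurableSet.of_discrete.nullMeasurableSet,
          measureReal_prod ν _ MeasurableSet.of_discrete]
        simp [MeasurableEquiv.piFinSuccAbove, Fin.insertNthEquiv]
    _ ≤ ∫ a, (c + (if a ∈ B then 1 else 0) * c') ∂ν := by
        refine integral_mono .of_finite .of_finite fun a => ?_
        by_cases ha : a ∈ B
        · simpa [ha] using hB a ha
        · simpa [ha] using hBc a ha
    _ = c + ν.real B * c' := by
        rw [integral_add .of_finite .of_finite, integral_const, probReal_univ, one_smul,
          integral_mul_const, integral_ite_one_zero, Set.ofPred_mem_eq]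

variable [CommMonoid M] {F : A → M} {V : M → ℝ} {q₀ D ρ : ℝ}

/-- Call a step a failure if it lowers `V` by less than `D`. As `t` successes bring `V` down to
`q₀`, `V` stays above `q₀` only if more than `m - t` of the `m` steps fail. -/
theorem measureReal_lt_mul_prod_fin_le (hV : ∀ g a, V (g * F a) ≤ V g) (hρ0 : 0 ≤ ρ) (hρ1 : ρ ≤ 1)
    (hstep : ∀ g, q₀ < V g → ν.real {a | V g - D < V (g * F a)} ≤ ρ) (m t : ℕ) (g : M)
    (hg : V g ≤ q₀ + t * D) :
    (Measure.pi fun _ : Fin m => ν).real {y | q₀ < V (g * ∏ i, F (y i))} ≤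
      2 ^ m * ρ ^ (m + 1 - t) := by
  induction m generalizing t g with
  | zero =>
    rcases Nat.eq_zero_or_pos t with rfl | ht
    · have : ¬ q₀ < V g := by simpa using hg
      simp [this, hρ0]
    · simp [Nat.sub_eq_zero_of_le ht, measureReal_le_one]
  | succ m ih =>
    rcases le_or_gt (V g) q₀ with hgq | hgq
    · have hempty : {y : Fin (m + 1) → A | q₀ < V (g * ∏ i, F (y i))} = ∅ :=
        Set.eq_empty_of_forall_notMem fun y hy =>
          hy.not_ge ((apply_mul_prod_le hV _ y g).trans hgq)
      rw [hempty, measureReal_empty]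
      positivity
    have ht : 1 ≤ t := Nat.one_le_iff_ne_zero.2 <| by
      rintro rfl
      simp only [Nat.cast_zero, zero_mul, add_zero] at hg
      exact hgq.not_ge hg
    set c := (2 : ℝ) ^ m * ρ ^ (m + 1 + 1 - t)
    set c' := (2 : ℝ) ^ m * ρ ^ (m + 1 - t)
    have hc : 0 ≤ c := by positivity
    have hρc : ρ * c' ≤ c := by
      rw [mul_left_comm, ← pow_succ']
      exact mul_le_mul_of_nonneg_left (pow_le_pow_of_le_one hρ0 hρ1 (by lia)) (by positivity)
    calc (Measure.pi fun _ : Fin (m + 1) => ν).real {y | q₀ < V (g * ∏ i, F (y i))}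
        ≤ c + ν.real {a | V g - D < V (g * F a)} * c' := by
          refine measureReal_pi_fin_succ_le (fun a _ => ?_) fun a ha => ?_
          all_goals simp only [Set.mem_ofPred_eq, Fin.prod_univ_succ, Fin.cons_zero,
            Fin.cons_succ, ← mul_assoc]
          · exact (ih t (g * F a) ((hV g a).trans hg)).trans (le_add_of_nonneg_left hc)
          · have hdrop : V (g * F a) ≤ V g - D := not_lt.1 ha
            have := ih (t - 1) (g * F a) (by rw [Nat.cast_sub ht]; push_cast; linarith)
            rwa [show m + 1 - (t - 1) = m + 1 + 1 - t by lia] at this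
      _ ≤ c + c := by
          gcongr
          exact (mul_le_mul_of_nonneg_right (hstep g hgq) (by positivity)).trans hρc
      _ = 2 ^ (m + 1) * ρ ^ (m + 1 + 1 - t) := by ring

theorem measureReal_lt_prod_le {ι : Type*} [Fintype ι] (hV : ∀ g a, V (g * F a) ≤ V g)
    (hρ0 : 0 ≤ ρ) (hρ1 : ρ ≤ 1)
    (hstep : ∀ g, q₀ < V g → ν.real {a | V g - D < V (g * F a)} ≤ ρ) (t : ℕ)
    (h1 : V 1 ≤ q₀ + t * D) :
    (Measure.pi fun _ : ι => ν).real {y | q₀ < V (∏ i, F (y i))} ≤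
      2 ^ Fintype.card ι * ρ ^ (Fintype.card ι + 1 - t) := by
  have h := measureReal_lt_mul_prod_fin_le hV hρ0 hρ1 hstep (Fintype.card ι) t 1 h1
  refine le_of_eq_of_le ?_ h
  have he := measurePreserving_piCongrLeft (fun _ : Fin (Fintype.card ι) => ν) (Fintype.equivFin ι)
  rw [← he.measureReal_preimage MeasurableSet.of_discrete.nullMeasurableSet]
  congr 1
  ext y
  have hprod : ∏ i, F (MeasurableEquiv.piCongrLeft (fun _ => A) (Fintype.equivFin ι) y i) =
      ∏ i, F (y i) := by
    rw [← (Fintype.equivFin ι).prod_comp]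
    simp [MeasurableEquiv.coe_piCongrLeft, Equiv.piCongrLeft_apply_apply]
  simp [hprod]

end Steps

section NodeLaw

variable {r P : ℕ} {μ : Fin r → ℝ} {K : Fin r → ℕ}

theorem nodeLaw_eq_sum : nodeLaw μ K P =
    ∑ i, ENNReal.ofReal (μ i) • (subsetLaw (Fin P) (K i)).map (Prod.mk i) := by
  simp_rw [← Measure.dirac_prod]
  rfl

instance : IsFiniteMeasure (nodeLaw μ K P) := by
  rw [nodeLaw_eq_sum]
  have : ∀ i, IsFiniteMeasure
      (ENNReal.ofReal (μ i) • (subsetLaw (Fin P) (K i)).map (Prod.mk i)) :=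
    fun i => Measure.smul_finite _ ENNReal.ofReal_ne_top
  infer_instance

theorem integral_nodeLaw (hμ : ∀ i, 0 ≤ μ i) (f : Fin r × Finset (Fin P) → ℝ) :
    ∫ a, f a ∂nodeLaw μ K P = ∑ i, μ i * ∫ S, f (i, S) ∂subsetLaw (Fin P) (K i) := by
  rw [nodeLaw_eq_sum, integral_finsetSum_measure fun i _ =>
    Integrable.of_finite.smul_measure ENNReal.ofReal_ne_top]
  refine Finset.sum_congr rfl fun i _ => ?_
  rw [integral_smul_measure, ENNReal.toReal_ofReal (hμ i), smul_eq_mul,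
    integral_map (by fun_prop) (by fun_prop)]

/-- The parameters of a network in which class `0` has the smallest key rings, which are not
empty, and any two key rings fit disjointly into the key pool. -/
structure Admissible [NeZero r] (μ : Fin r → ℝ) (K : Fin r → ℕ) (P : ℕ) : Prop where
  μ_nonneg : ∀ i, 0 ≤ μ i
  μ_sum : ∑ i, μ i = 1
  K_zero_pos : 0 < K 0
  K_zero_le : ∀ i, K 0 ≤ K i
  add_le : ∀ i j, K i + K j ≤ P

namespace Admissible

variable [NeZero r] (h : Admissible μ K P)
include h

theorem le_card (i : Fin r) : K i ≤ Fintype.card (Fin P) := by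
  rw [Fintype.card_fin]
  exact le_of_add_le_left (h.add_le i i)

theorem K_pos (i : Fin r) : 0 < K i := h.K_zero_pos.trans_le (h.K_zero_le i)

theorem isProbabilityMeasure_subsetLaw (i : Fin r) :
    IsProbabilityMeasure (subsetLaw (Fin P) (K i)) :=
  HeterogeneousKeyGraph.isProbabilityMeasure_subsetLaw (h.le_card i)

theorem integral_snd_nodeLaw_le {f : Finset (Fin P) → ℝ} {c : ℝ}
    (hc : ∀ i, ∫ S, f S ∂subsetLaw (Fin P) (K i) ≤ c) : ∫ a, f a.2 ∂nodeLaw μ K P ≤ c := by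
  rw [integral_nodeLaw h.μ_nonneg]
  calc _ ≤ ∑ i, μ i * c :=
        Finset.sum_le_sum fun i _ => mul_le_mul_of_nonneg_left (hc i) (h.μ_nonneg i)
    _ = c := by rw [← Finset.sum_mul, h.μ_sum, one_mul]

theorem isProbabilityMeasure_nodeLaw : IsProbabilityMeasure (nodeLaw μ K P) := by
  have hsub := h.isProbabilityMeasure_subsetLaw
  have hone := integral_nodeLaw (P := P) (K := K) h.μ_nonneg fun _ => 1
  simp only [integral_const, smul_eq_mul, mul_one, probReal_univ, h.μ_sum] at hone
  exact isProbabilityMeasure_iff_real.2 hone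

theorem measureReal_snd_nodeLaw_le {p : Finset (Fin P) → Prop} {c : ℝ}
    (hc : ∀ i, (subsetLaw (Fin P) (K i)).real {S | p S} ≤ c) :
    (nodeLaw μ K P).real {a | p a.2} ≤ c := by
  classical
  simp_rw [← integral_ite_one_zero] at hc ⊢
  exact h.integral_snd_nodeLaw_le hc

end Admissible

end NodeLaw

section Avoid

variable {r P : ℕ} {μ : Fin r → ℝ} {K : Fin r → ℕ} {ι : Type*} [Fintype ι]

/-- The conditional probability that two nodes with key rings `S` and `T` are not adjacent, as an
element of the monoid `[0, 1]`. -/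
def miss (α : unitInterval) (S T : Finset (Fin P)) : unitInterval :=
  if Disjoint S T then 1 else unitInterval.symm α

theorem coe_miss (α : unitInterval) (S T : Finset (Fin P)) :
    (miss α S T : ℝ) = 1 - α * hit S T := by
  unfold miss hit
  split_ifs <;> simp

/-- The probability that a node with a random key ring of size `k` has no edge to any of the nodes
`y`, given the classes and key rings of the latter. -/
def avoid (α : unitInterval) (k : ℕ) (y : ι → Fin r × Finset (Fin P)) : ℝ :=
  ∫ S, ∏ i, (miss α (y i).2 S : ℝ) ∂subsetLaw (Fin P) k

theorem avoid_nonneg (α : unitInterval) (k : ℕ) (y : ι → Fin r × Finset (Fin P)) :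
    0 ≤ avoid α k y :=
  integral_nonneg fun _ => Finset.prod_nonneg fun _ _ => (miss α _ _).2.1

theorem avoid_le_one (α : unitInterval) {k : ℕ} (hk : k ≤ Fintype.card (Fin P))
    (y : ι → Fin r × Finset (Fin P)) : avoid α k y ≤ 1 := by
  have := isProbabilityMeasure_subsetLaw hk
  simpa [avoid] using integral_mono (μ := subsetLaw (Fin P) k) .of_finite .of_finite
    fun S => Finset.prod_le_one (fun i _ => (miss α (y i).2 S).2.1) fun i _ => (miss α _ S).2.2

theorem integral_mul_miss (α : unitInterval) (k : ℕ) (g : Finset (Fin P) → ℝ)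
    (T : Finset (Fin P)) :
    ∫ S, g S * miss α T S ∂subsetLaw (Fin P) k =
      ∫ S, g S ∂subsetLaw (Fin P) k - α * ∫ S, g S * hit T S ∂subsetLaw (Fin P) k := by
  simp_rw [coe_miss, mul_sub, mul_one, mul_left_comm (g _)]
  rw [integral_sub .of_finite .of_finite, integral_const_mul]

namespace Admissible

variable [NeZero r] (h : Admissible μ K P)
include h

/-- The nodes `y` are revealed one by one; `g` is the conditional probability, as a function of the
key ring of a further node, that the latter has no edge to those revealed so far. -/
theorem measureReal_lt_avoid_le {α : unitInterval} (hα : 0 < (α : ℝ)) (j : Fin r) {t : ℕ}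
    {c q₀ ρ : ℝ} (hρ0 : 0 ≤ ρ) (hρ1 : ρ ≤ 1) (ht : 1 ≤ q₀ + t * (α * c))
    (hstep : ∀ g : Finset (Fin P) → unitInterval,
      q₀ < ∫ S, (g S : ℝ) ∂subsetLaw (Fin P) (K j) → ∀ i, (subsetLaw (Fin P) (K i)).real
        {T | ∫ S, (g S : ℝ) * hit T S ∂subsetLaw (Fin P) (K j) < c} ≤ ρ) :
    (Measure.pi fun _ : ι => nodeLaw μ K P).real {y | q₀ < avoid α (K j) y} ≤
      2 ^ Fintype.card ι * ρ ^ (Fintype.card ι + 1 - t) := by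
  have := h.isProbabilityMeasure_nodeLaw
  have := h.isProbabilityMeasure_subsetLaw j
  set F : Fin r × Finset (Fin P) → Finset (Fin P) → unitInterval := fun a S => miss α a.2 S
  set V : (Finset (Fin P) → unitInterval) → ℝ := fun g => ∫ S, (g S : ℝ) ∂subsetLaw (Fin P) (K j)
  have hV : ∀ g a, V (g * F a) ≤ V g := fun g a =>
    integral_mono .of_finite .of_finite fun S => mul_le_of_le_one_right (g S).2.1 (F a S).2.2
  have hone : V 1 ≤ q₀ + t * (α * c) := by simpa [V] using ht
  have havoid : ∀ y : ι → Fin r × Finset (Fin P), avoid α (K j) y = V (∏ i, F (y i)) := fun y => by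
    let coe : unitInterval →* ℝ := ⟨⟨(↑), Set.Icc.coe_one⟩, Set.Icc.coe_mul⟩
    have hcoe : ∀ S, ((∏ i, F (y i) S : unitInterval) : ℝ) = ∏ i, (F (y i) S : ℝ) := fun S =>
      map_prod coe (fun i => F (y i) S) Finset.univ
    simp only [V, avoid, Finset.prod_apply, hcoe, F]
  have hstepV : ∀ g, q₀ < V g → (nodeLaw μ K P).real {a | V g - α * c < V (g * F a)} ≤ ρ := by
    refine fun g hg => (measureReal_mono fun a ha => ?_).trans
      (h.measureReal_snd_nodeLaw_le (hstep g hg))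
    have hlt : V g - α * c < V (g * F a) := ha
    have hVF : V (g * F a) = V g - α * ∫ S, (g S : ℝ) * hit a.2 S ∂subsetLaw (Fin P) (K j) :=
      integral_mul_miss α (K j) (fun S => (g S : ℝ)) a.2
    exact lt_of_mul_lt_mul_left (a := (α : ℝ)) (by linarith) hα.le
  simp_rw [havoid]
  exact measureReal_lt_prod_le hV hρ0 hρ1 hstepV t hone

theorem measureReal_one_sub_lt_avoid_le {α : unitInterval} (hα : 0 < (α : ℝ)) (j : Fin r)
    {t L : ℕ} {q x : ℝ} (hq : 1 ≤ q) (hL : q * L ≤ K 0) (hx0 : 0 ≤ x)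
    (hx : t * ((α : ℝ) * ((1 - 4 / q) * shareProb P (K 0) (K j))) ≤ x) (hqx : 3 * (q ^ 2 * x) ≤ 1) :
    (Measure.pi fun _ : ι => nodeLaw μ K P).real
        {y | 1 - t * ((α : ℝ) * ((1 - 4 / q) * shareProb P (K 0) (K j))) < avoid α (K j) y} ≤
      2 ^ Fintype.card ι * ((3 * (q ^ 2 * x)) ^ L) ^ (Fintype.card ι + 1 - t) := by
  refine h.measureReal_lt_avoid_le hα j (by positivity) (pow_le_one₀ (by positivity) hqx)
    (sub_add_cancel _ _).ge fun g hg i => ?_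
  have := measureReal_integral_mul_hit_lt_le_pow (l := K i) (q := q)
    (by simpa using h.add_le 0 j) (h.K_pos j) (h.K_zero_le i) (fun S => (g S).2.1)
    (fun S => (g S).2.2) hq hL ((sub_le_sub_left hx 1).trans hg.le) hqx
  rwa [Fintype.card_fin] at this

theorem measureReal_lt_avoid_le_of_le {α : unitInterval} (hα : 0 < (α : ℝ)) (j : Fin r) {t : ℕ}
    {d : ℝ} (hd : 0 < d) (ht : 1 ≤ d + t * ((α : ℝ) * (d ^ 2 / 8 * shareProb P (K 0) (K j))))
    (hρ : 4 / (K 0 * d ^ 2) ≤ 1) :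
    (Measure.pi fun _ : ι => nodeLaw μ K P).real {y | d < avoid α (K j) y} ≤
      2 ^ Fintype.card ι * (4 / (K 0 * d ^ 2)) ^ (Fintype.card ι + 1 - t) := by
  refine h.measureReal_lt_avoid_le hα j (by positivity) hρ ht fun g hg i => ?_
  have := measureReal_integral_mul_hit_lt_le (l := K i) (by simpa using h.add_le 0 j)
    h.K_zero_pos (h.K_pos j) (h.K_zero_le i) (fun S => (g S).2.1) (fun S => (g S).2.2) hd hg.le
  rwa [Fintype.card_fin] at this

end Admissible

end Avoid

/-! ### Edges between sets of nodes -/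

section Model

instance {V : Type*} [Finite V] : DiscreteMeasurableSpace (SimpleGraph V) where
  forall_measurableSet s := by
    rw [← SimpleGraph.measurableEmbedding_edgeSet.measurableSet_image]
    exact (Set.toFinite _).measurableSet

theorem measureReal_binomialRandom_forall_notMem {V : Type*} [Finite V] (α : unitInterval)
    (F : Finset (Sym2 V)) (hF : ∀ e ∈ F, ¬ e.IsDiag) :
    (SimpleGraph.binomialRandom V α).real {G | ∀ e ∈ F, e ∉ G.edgeSet} =
      (1 - (α : ℝ)) ^ F.card := by
  have hmap : (SimpleGraph.binomialRandom V α) {G | ∀ e ∈ F, e ∉ G.edgeSet} =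
      (setBernoulli (Sym2.diagSetᶜ : Set (Sym2 V)) α) {E | ∀ e ∈ F, e ∉ E} := by
    rw [SimpleGraph.binomialRandom_eq_map, Measure.map_apply (by fun_prop) .of_discrete]
    congr 1
    ext E
    simp only [Set.mem_preimage, Set.mem_ofPred_eq, SimpleGraph.edgeSet_fromEdgeSet]
    exact forall₂_congr fun e he => by simp [hF e he]
  have hprod : (setBernoulli (Sym2.diagSetᶜ : Set (Sym2 V)) α) {E | ∀ e ∈ F, e ∉ E} =
      ∏ _ ∈ F, (unitInterval.toNNReal (unitInterval.symm α) : ENNReal) := by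
    have hpi : (fun p : Sym2 V → Prop ↦ {e | p e}) ⁻¹' {E | ∀ e ∈ F, e ∉ E} =
        Set.pi (F : Set (Sym2 V)) fun _ => {False} := by
      ext p
      simp [Set.pi]
    rw [setBernoulli_apply', hpi, Measure.infinitePi_pi _ fun _ _ => .of_discrete]
    exact Finset.prod_congr rfl fun e he => by simp [hF e he]
  rw [measureReal_def, hmap, hprod]
  simp

theorem injOn_sym2Mk_of_disjoint {V : Type*} {S T : Finset V} (h : Disjoint S T) :
    Set.InjOn (fun p : V × V => s(p.1, p.2)) (S ×ˢ T : Finset (V × V)) := by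
  rintro ⟨a, b⟩ hab ⟨c, d⟩ hcd heq
  simp only [Finset.coe_product, Set.mem_prod, Finset.mem_coe] at hab hcd
  rcases Sym2.eq_iff.1 heq with ⟨hac, hbd⟩ | ⟨had, -⟩
  · exact Prod.ext hac hbd
  · exact absurd hcd.2 (Finset.disjoint_left.1 h ((show a = d from had) ▸ hab.1))

/-- No edge of `G` joins `S` to `T`. -/
def NoEdge {V : Type*} (G : SimpleGraph V) (S T : Finset V) : Prop :=
  ∀ u ∈ S, ∀ v ∈ T, ¬ G.Adj u v

variable {n r P : ℕ} {μ : Fin r → ℝ} {K : Fin r → ℕ} {α : unitInterval}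

theorem measureReal_binomialRandom_noEdge (α : unitInterval) (x : Fin n → Fin r × Finset (Fin P))
    {S T : Finset (Fin n)} (h : Disjoint S T) :
    (SimpleGraph.binomialRandom (Fin n) α).real {G | NoEdge (keyGraph x ⊓ G) S T} =
      ∏ v ∈ T, ∏ u ∈ S, (miss α (x u).2 (x v).2 : ℝ) := by
  set E := {p ∈ S ×ˢ T | ¬ Disjoint (x p.1).2 (x p.2).2} with hE
  have hne : ∀ p ∈ S ×ˢ T, p.1 ≠ p.2 := fun p hp =>
    (Finset.disjoint_iff_ne.1 h) _ (Finset.mem_product.1 hp).1 _ (Finset.mem_product.1 hp).2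
  have hedges : {G : SimpleGraph (Fin n) | NoEdge (keyGraph x ⊓ G) S T} =
      {G | ∀ e ∈ E.image fun p : Fin n × Fin n => s(p.1, p.2), e ∉ G.edgeSet} := by
    ext G
    simp only [NoEdge, keyGraph, hE, Set.mem_ofPred_eq, Finset.forall_mem_image,
      Finset.mem_filter, Finset.mem_product, Prod.forall, SimpleGraph.inf_adj,
      SimpleGraph.mem_edgeSet, Finset.not_disjoint_iff_nonempty_inter]
    refine ⟨fun hG u v huv hadj => hG u huv.1.1 v huv.1.2
      ⟨⟨hne (u, v) (Finset.mem_product.2 huv.1), huv.2⟩, hadj⟩,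
      fun hG u hu v hv hadj => hG u v ⟨⟨hu, hv⟩, hadj.1.2⟩ hadj.2⟩
  have hnotDiag : ∀ e ∈ E.image fun p : Fin n × Fin n => s(p.1, p.2), ¬ e.IsDiag :=
    Finset.forall_mem_image.2 fun p hp => by simpa using hne p (Finset.mem_filter.1 hp).1
  rw [hedges, measureReal_binomialRandom_forall_notMem α _ hnotDiag,
    Finset.card_image_of_injOn ((injOn_sym2Mk_of_disjoint h).mono
      (Finset.coe_subset.2 (Finset.filter_subset _ _))), Finset.card_filter,
    ← Finset.prod_pow_eq_pow_sum, Finset.prod_comm, ← Finset.prod_product']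
  refine Finset.prod_congr rfl fun p _ => ?_
  unfold miss
  split_ifs <;> simp_all

theorem measureReal_modelMeasure_noEdge (Φ : (Fin n → Fin r × Finset (Fin P)) → Prop)
    [DecidablePred Φ] {S T : Finset (Fin n)} (h : Disjoint S T) :
    (modelMeasure n μ K P α).real {ω | Φ ω.1 ∧ NoEdge (network ω) S T} =
      ∫ x, (if Φ x then ∏ v ∈ T, ∏ u ∈ S, (miss α (x u).2 (x v).2 : ℝ) else 0)
        ∂Measure.pi fun _ => nodeLaw μ K P := by
  rw [modelMeasure, measureReal_prod _ _ .of_discrete]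
  refine integral_congr_ae (.of_forall fun x => ?_)
  dsimp only
  split_ifs with hx
  · rw [← measureReal_binomialRandom_noEdge α x h]
    simp [hx, network]
  · simp [hx]

end Model

namespace Admissible

variable {n r P : ℕ} [NeZero r] {μ : Fin r → ℝ} {K : Fin r → ℕ} {α : unitInterval}
  (h : Admissible μ K P)
include h

theorem isProbabilityMeasure_modelMeasure : IsProbabilityMeasure (modelMeasure n μ K P α) := by
  have := h.isProbabilityMeasure_nodeLaw
  unfold modelMeasure
  infer_instance

theorem measureReal_noEdge_and {S T : Finset (Fin n)} (hST : Disjoint S T)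
    (D : (S → Fin r × Finset (Fin P)) → Prop) [DecidablePred D] (C : Fin r → Prop)
    [DecidablePred C] :
    (modelMeasure n μ K P α).real
        {ω | (D (S.restrict ω.1) ∧ ∀ v ∈ T, C (ω.1 v).1) ∧ NoEdge (network ω) S T} =
      ∫ y, (if D y then 1 else 0) * (∑ i with C i, μ i * avoid α (K i) y) ^ T.card
        ∂Measure.pi fun _ => nodeLaw μ K P := by
  have := h.isProbabilityMeasure_nodeLaw
  let F : (S → Fin r × Finset (Fin P)) → Fin r × Finset (Fin P) → ℝ := fun y a =>
    if C a.1 then ∏ u, (miss α (y u).2 a.2 : ℝ) else 0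
  have hF : ∀ y, ∫ a, F y a ∂nodeLaw μ K P = ∑ i with C i, μ i * avoid α (K i) y := fun y => by
    rw [integral_nodeLaw h.μ_nonneg, Finset.sum_filter]
    refine Finset.sum_congr rfl fun i _ => ?_
    dsimp only [F]
    split_ifs <;> simp [avoid]
  rw [measureReal_modelMeasure_noEdge (fun x => D (S.restrict x) ∧ ∀ v ∈ T, C (x v).1) hST]
  simp_rw [← hF]
  rw [← integral_pi_mul_prod (nodeLaw μ K P) hST (fun y => if D y then 1 else 0) F]
  refine integral_congr_ae (.of_forall fun x => ?_)
  have hprod : ∏ v ∈ T, F (S.restrict x) (x v) =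
      if ∀ v ∈ T, C (x v).1 then ∏ v ∈ T, ∏ u ∈ S, (miss α (x u).2 (x v).2 : ℝ) else 0 := by
    simp only [F, ← Finset.prod_coe_sort S, Finset.restrict_def, Finset.prod_ite_zero]
    congr
  by_cases hD : D (S.restrict x) <;> simp [hD, hprod]

theorem measureReal_noEdge {S T : Finset (Fin n)} (hST : Disjoint S T) :
    (modelMeasure n μ K P α).real {ω | NoEdge (network ω) S T} =
      ∫ y : S → Fin r × Finset (Fin P), (∑ i, μ i * avoid α (K i) y) ^ T.card
        ∂Measure.pi fun _ => nodeLaw μ K P := by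
  simpa using h.measureReal_noEdge_and (α := α) hST (fun _ => True) fun _ => True

theorem measureReal_noEdge_and_class_eq {S T : Finset (Fin n)} (hST : Disjoint S T) (j : Fin r) :
    (modelMeasure n μ K P α).real {ω | (∀ v ∈ T, (ω.1 v).1 = j) ∧ NoEdge (network ω) S T} =
      ∫ y : S → Fin r × Finset (Fin P), (μ j * avoid α (K j) y) ^ T.card
        ∂Measure.pi fun _ => nodeLaw μ K P := by
  simpa [Finset.filter_eq'] using
    h.measureReal_noEdge_and (α := α) hST (fun _ => True) fun i => i = j

end Admissible

theorem integral_le_measureReal_add {Ω : Type*} [MeasurableSpace Ω] [DiscreteMeasurableSpace Ω]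
    [Finite Ω] {M : Measure Ω} [IsProbabilityMeasure M] {f : Ω → ℝ} {p : Ω → Prop} {c : ℝ}
    (hc : 0 ≤ c) (hf : ∀ ω, f ω ≤ 1) (h : ∀ ω, ¬ p ω → f ω ≤ c) :
    ∫ ω, f ω ∂M ≤ M.real {ω | p ω} + c := by
  classical
  calc ∫ ω, f ω ∂M ≤ ∫ ω, ((if p ω then 1 else 0) + c) ∂M := by
        refine integral_mono .of_finite .of_finite fun ω => ?_
        dsimp only
        split_ifs with hω
        · linarith [hf ω]
        · linarith [h ω hω]
    _ = M.real {ω | p ω} + c := by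
        rw [integral_add .of_finite .of_finite, integral_ite_one_zero]
        simp

/-- The probability that a node of class `0` is adjacent to another given node. -/
def edgeProb {r : ℕ} [NeZero r] (μ : Fin r → ℝ) (K : Fin r → ℕ) (P : ℕ) (α : unitInterval) : ℝ :=
  α * ∑ j, μ j * shareProb P (K 0) (K j)

namespace Admissible

variable {n r P : ℕ} [NeZero r] {μ : Fin r → ℝ} {K : Fin r → ℕ} {α : unitInterval}
  (h : Admissible μ K P)
include h

theorem shareProb_nonneg (j : Fin r) : 0 ≤ shareProb P (K 0) (K j) :=
  HeterogeneousKeyGraph.shareProb_nonneg (h.add_le 0 j)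

theorem edgeProb_nonneg : 0 ≤ edgeProb μ K P α :=
  mul_nonneg α.2.1 (Finset.sum_nonneg fun j _ => mul_nonneg (h.μ_nonneg j) (h.shareProb_nonneg j))

theorem mul_shareProb_le {μ₀ : ℝ} (hμ₀ : 0 < μ₀) (hμ : ∀ i, μ₀ ≤ μ i) (j : Fin r) :
    α * shareProb P (K 0) (K j) ≤ edgeProb μ K P α / μ₀ := by
  have hterm : μ j * shareProb P (K 0) (K j) ≤ ∑ i, μ i * shareProb P (K 0) (K i) :=
    Finset.single_le_sum (f := fun i => μ i * shareProb P (K 0) (K i))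
      (fun i _ => mul_nonneg (h.μ_nonneg i) (h.shareProb_nonneg i)) (Finset.mem_univ j)
  rw [le_div_iff₀ hμ₀, edgeProb, mul_assoc, mul_comm _ μ₀]
  exact mul_le_mul_of_nonneg_left
    ((mul_le_mul_of_nonneg_right (hμ j) (h.shareProb_nonneg j)).trans hterm) α.2.1

theorem exists_edgeProb_le : ∃ j, edgeProb μ K P α ≤ α * shareProb P (K 0) (K j) := by
  obtain ⟨j, -, hj⟩ := Finset.exists_max_image Finset.univ (fun j => shareProb P (K 0) (K j))
    Finset.univ_nonempty
  refine ⟨j, mul_le_mul_of_nonneg_left ?_ α.2.1⟩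
  calc ∑ i, μ i * shareProb P (K 0) (K i) ≤ ∑ i, μ i * shareProb P (K 0) (K j) :=
        Finset.sum_le_sum fun i hi => mul_le_mul_of_nonneg_left (hj i hi) (h.μ_nonneg i)
    _ = shareProb P (K 0) (K j) := by rw [← Finset.sum_mul, h.μ_sum, one_mul]

theorem sum_mul_avoid_nonneg {ι : Type*} [Fintype ι] (y : ι → Fin r × Finset (Fin P)) :
    0 ≤ ∑ i, μ i * avoid α (K i) y :=
  Finset.sum_nonneg fun i _ => mul_nonneg (h.μ_nonneg i) (avoid_nonneg α _ y)

theorem sum_mul_avoid_le_one {ι : Type*} [Fintype ι] (y : ι → Fin r × Finset (Fin P)) :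
    ∑ i, μ i * avoid α (K i) y ≤ 1 := by
  rw [← h.μ_sum]
  exact Finset.sum_le_sum fun i _ =>
    mul_le_of_le_one_right (h.μ_nonneg i) (avoid_le_one α (h.le_card i) y)

theorem sum_mul_avoid_le_exp {ι : Type*} [Fintype ι] {y : ι → Fin r × Finset (Fin P)} {κ s : ℝ}
    (hy : ∀ j, avoid α (K j) y ≤ 1 - s * (α * (κ * shareProb P (K 0) (K j)))) :
    ∑ i, μ i * avoid α (K i) y ≤ Real.exp (-(s * (κ * edgeProb μ K P α))) := by
  calc _ ≤ ∑ i, μ i * (1 - s * (α * (κ * shareProb P (K 0) (K i)))) :=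
        Finset.sum_le_sum fun i _ => mul_le_mul_of_nonneg_left (hy i) (h.μ_nonneg i)
    _ = ∑ i, μ i - s * (κ * edgeProb μ K P α) := by
        simp_rw [edgeProb, Finset.mul_sum, ← Finset.sum_sub_distrib]
        exact Finset.sum_congr rfl fun i _ => by ring
    _ ≤ _ := by
        rw [h.μ_sum]
        exact Real.one_sub_le_exp_neg _

theorem measureReal_noEdge_le (hα : 0 < (α : ℝ)) {μ₀ : ℝ} (hμ₀ : 0 < μ₀) (hμ : ∀ i, μ₀ ≤ μ i)
    {q x : ℝ} {L t : ℕ} (hq : 1 ≤ q) (hL : q * L ≤ K 0) (hx : t * (edgeProb μ K P α / μ₀) ≤ x)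
    (hqx : 3 * (q ^ 2 * x) ≤ 1) {S T : Finset (Fin n)} (hST : Disjoint S T) :
    (modelMeasure n μ K P α).real {ω | NoEdge (network ω) S T} ≤
      r * (2 ^ S.card * ((3 * (q ^ 2 * x)) ^ L) ^ (S.card + 1 - t)) +
        Real.exp (-(T.card * (t * ((1 - 4 / q) * edgeProb μ K P α)))) := by
  have := h.isProbabilityMeasure_nodeLaw
  have hκ1 : 1 - 4 / q ≤ 1 := sub_le_self _ (by positivity)
  have hx0 : 0 ≤ x :=
    (mul_nonneg t.cast_nonneg (div_nonneg h.edgeProb_nonneg hμ₀.le)).trans hx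
  have hxj : ∀ j, t * ((α : ℝ) * ((1 - 4 / q) * shareProb P (K 0) (K j))) ≤ x := fun j => by
    refine le_trans (mul_le_mul_of_nonneg_left ?_ t.cast_nonneg) hx
    exact (mul_le_mul_of_nonneg_left (mul_le_of_le_one_left (h.shareProb_nonneg j) hκ1)
      α.2.1).trans (h.mul_shareProb_le hμ₀ hμ j)
  let bad : Fin r → (S → Fin r × Finset (Fin P)) → Prop := fun j y =>
    1 - t * ((α : ℝ) * ((1 - 4 / q) * shareProb P (K 0) (K j))) < avoid α (K j) y
  have hbad : (Measure.pi fun _ : S => nodeLaw μ K P).real {y | ∃ j, bad j y} ≤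
      r * (2 ^ S.card * ((3 * (q ^ 2 * x)) ^ L) ^ (S.card + 1 - t)) := by
    rw [Set.ofPred_exists]
    calc _ ≤ ∑ j, (Measure.pi fun _ : S => nodeLaw μ K P).real {y | bad j y} :=
          measureReal_iUnion_fintype_le _
      _ ≤ ∑ _j : Fin r, 2 ^ S.card * ((3 * (q ^ 2 * x)) ^ L) ^ (S.card + 1 - t) :=
          Finset.sum_le_sum fun j _ => by
            simpa using h.measureReal_one_sub_lt_avoid_le (ι := S) hα j hq hL hx0 (hxj j) hqx
      _ = _ := by simp
  rw [h.measureReal_noEdge hST]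
  refine (integral_le_measureReal_add (p := fun y => ∃ j, bad j y) (Real.exp_nonneg _)
    (fun y => pow_le_one₀ (h.sum_mul_avoid_nonneg y) (h.sum_mul_avoid_le_one y))
    fun y hy => ?_).trans (add_le_add_left hbad _)
  simp only [bad, not_exists, not_lt] at hy
  rw [← mul_neg, Real.exp_nat_mul]
  exact pow_le_pow_left₀ (h.sum_mul_avoid_nonneg y) (h.sum_mul_avoid_le_exp hy) _

theorem μ_le_one (j : Fin r) : μ j ≤ 1 :=
  h.μ_sum ▸ Finset.single_le_sum (fun i _ => h.μ_nonneg i) (Finset.mem_univ j)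

theorem measureReal_noEdge_and_class_eq_le (hα : 0 < (α : ℝ)) {d : ℝ} (hd : 0 < d) (j : Fin r)
    {t : ℕ} (ht : 1 ≤ d + t * ((α : ℝ) * (d ^ 2 / 8 * shareProb P (K 0) (K j))))
    (hρ : 4 / (K 0 * d ^ 2) ≤ 1) {S T : Finset (Fin n)} (hST : Disjoint S T) :
    (modelMeasure n μ K P α).real {ω | (∀ v ∈ T, (ω.1 v).1 = j) ∧ NoEdge (network ω) S T} ≤
      2 ^ S.card * (4 / (K 0 * d ^ 2)) ^ (S.card + 1 - t) + d ^ T.card := by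
  have := h.isProbabilityMeasure_nodeLaw
  have hle : ∀ y : S → Fin r × Finset (Fin P), μ j * avoid α (K j) y ≤ avoid α (K j) y :=
    fun y => mul_le_of_le_one_left (avoid_nonneg α _ y) (h.μ_le_one j)
  have hnonneg : ∀ y : S → Fin r × Finset (Fin P), 0 ≤ μ j * avoid α (K j) y :=
    fun y => mul_nonneg (h.μ_nonneg j) (avoid_nonneg α _ y)
  have hbad := h.measureReal_lt_avoid_le_of_le (ι := S) hα j hd ht hρ
  rw [Fintype.card_coe] at hbad
  rw [h.measureReal_noEdge_and_class_eq hST]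
  exact (integral_le_measureReal_add (p := fun y => d < avoid α (K j) y) (by positivity)
    (fun y => pow_le_one₀ (hnonneg y) ((hle y).trans (avoid_le_one α (h.le_card j) y)))
    fun y hy => pow_le_pow_left₀ (hnonneg y) ((hle y).trans (not_lt.1 hy)) _).trans
    (add_le_add_left hbad _)

end Admissible

/-! ### Connectivity above the threshold -/

theorem measureReal_pi_card_filter_lt_le {ι A : Type*} [Fintype ι] [Nonempty ι] [Finite A]
    [MeasurableSpace A] [DiscreteMeasurableSpace A] (ν : Measure A) [IsProbabilityMeasure ν]
    {p : A → Prop} [DecidablePred p] (hp : 0 < ν.real {a | p a}) :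
    (Measure.pi fun _ : ι => ν).real
        {x | (Finset.card {i | p (x i)} : ℝ) < ν.real {a | p a} / 2 * Fintype.card ι} ≤
      4 / (ν.real {a | p a} * Fintype.card ι) := by
  set N : ℝ := (Fintype.card ι : ℝ)
  set m := ν.real {a | p a}
  have hN : 0 < N := Nat.cast_pos.2 Fintype.card_pos
  let X : A → ℝ := fun a => if p a then 1 else 0
  let Z : (ι → A) → ℝ := ∑ i, fun x => X (x i)
  have hZ : ∀ x, Z x = Finset.card {i | p (x i)} := fun x => by simp [Z, X]
  have hmean : ∫ x, Z x ∂Measure.pi (fun _ => ν) = m * N := by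
    have hX : ∀ i, ∫ x : ι → A, X (x i) ∂Measure.pi (fun _ => ν) = m := fun i => by
      rw [integral_comp_eval (μ := fun _ => ν) (by fun_prop), integral_ite_one_zero]
    simp only [Z, Finset.sum_apply]
    rw [integral_finsetSum _ fun i _ => .of_finite]
    simp [hX, N, mul_comm]
  have hvar : Var[Z; Measure.pi fun _ => ν] ≤ m * N := by
    have hX : Var[X; ν] ≤ m := by
      refine (variance_le_expectation_sq (by fun_prop)).trans_eq ?_
      simp only [Pi.pow_apply, X, ite_pow, one_pow, ne_eq, OfNat.ofNat_ne_zero, not_false_eq_true,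
        zero_pow]
      exact integral_ite_one_zero ν p
    rw [variance_sum_pi fun _ => .of_discrete]
    simpa [N, mul_comm] using mul_le_mul_of_nonneg_left hX hN.le
  have hcheb := ENNReal.toReal_le_of_le_ofReal (div_nonneg (variance_nonneg _ _) (sq_nonneg _))
    (meas_ge_le_variance_div_sq (μ := Measure.pi fun _ => ν) (X := Z) .of_discrete
      (show 0 < m * N / 2 by positivity))
  rw [hmean] at hcheb
  calc _ ≤ (Measure.pi fun _ => ν).real {x | m * N / 2 ≤ |Z x - m * N|} :=
        measureReal_mono fun x (hx : (Finset.card {i | p (x i)} : ℝ) < m / 2 * N) => by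
          rw [← hZ] at hx
          exact (le_abs.2 (.inr (by linarith)) : m * N / 2 ≤ |Z x - m * N|)
    _ ≤ m * N / (m * N / 2) ^ 2 := hcheb.trans (by gcongr)
    _ = 4 / (m * N) := by field_simp; norm_num

theorem exists_noEdge_compl_of_not_connected {V : Type*} [Fintype V] [DecidableEq V] [Nonempty V]
    {G : SimpleGraph V} (hG : ¬ G.Connected) :
    ∃ S : Finset V, S.Nonempty ∧ 2 * S.card ≤ Fintype.card V ∧ NoEdge G S Sᶜ := by
  classical
  simp only [SimpleGraph.connected_iff, SimpleGraph.Preconnected, not_and_or, not_forall,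
    not_nonempty_iff, not_isEmpty_of_nonempty, or_false] at hG
  obtain ⟨a, b, hab⟩ := hG
  set S : Finset V := {w | G.Reachable a w} with hS
  have hcut : NoEdge G S Sᶜ := fun u hu v hv hadj => by
    simp only [hS, Finset.mem_compl, Finset.mem_filter_univ] at hu hv
    exact hv (hu.trans hadj.reachable)
  have hcard := S.card_add_card_compl
  rcases le_total (2 * S.card) (Fintype.card V) with hle | hle
  · exact ⟨S, ⟨a, by simp [hS]⟩, hle, hcut⟩
  · refine ⟨Sᶜ, ⟨b, by simpa [hS] using hab⟩, by lia, fun u hu v hv hadj => ?_⟩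
    exact hcut v (by simpa using hv) u hu hadj.symm

theorem exists_noEdge_of_not_connected {V : Type*} [Fintype V] [DecidableEq V] [Nonempty V]
    {G : SimpleGraph V} (hG : ¬ G.Connected) (J : Finset V) {s m : ℝ}
    (hm : 2 * m ≤ J.card) :
    (∃ S : Finset V, (S.Nonempty ∧ S.card ≤ s) ∧ NoEdge G S Sᶜ) ∨
      ∃ A : Finset V × Finset V, (Disjoint A.1 A.2 ∧ s ≤ A.1.card ∧ m ≤ A.2.card) ∧
        (∀ v ∈ A.2, v ∈ J) ∧ NoEdge G A.1 A.2 := by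
  obtain ⟨S, hS, hSle, hcut⟩ := exists_noEdge_compl_of_not_connected hG
  rcases le_or_gt (S.card : ℝ) s with hsmall | hlarge
  · exact .inl ⟨S, ⟨hS, hsmall⟩, hcut⟩
  have hScard : (S.card : ℝ) + Sᶜ.card = Fintype.card V := mod_cast S.card_add_card_compl
  have hJcard : ((J \ S).card : ℝ) + (J ∩ S).card = J.card :=
    mod_cast Finset.card_sdiff_add_card_inter J S
  have hSle' : 2 * (S.card : ℝ) ≤ Fintype.card V := mod_cast hSle
  right
  rcases le_total m (J \ S).card with hmany | hfew
  · refine ⟨(S, J \ S), ⟨Finset.disjoint_sdiff, hlarge.le, hmany⟩, fun v hv =>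
      (Finset.mem_sdiff.1 hv).1, fun u hu v hv => hcut u hu v ?_⟩
    exact Finset.mem_compl.2 (Finset.mem_sdiff.1 hv).2
  · refine ⟨(Sᶜ, J ∩ S), ⟨?_, by dsimp only; linarith, by dsimp only; linarith⟩, fun v hv =>
      (Finset.mem_inter.1 hv).1, fun u hu v hv hadj =>
      hcut v (Finset.mem_inter.1 hv).2 u hu hadj.symm⟩
    exact disjoint_compl_left.mono_right Finset.inter_subset_right

namespace Admissible

variable {n r P : ℕ} [NeZero r] {μ : Fin r → ℝ} {K : Fin r → ℕ} {α : unitInterval}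
  (h : Admissible μ K P)
include h

theorem measureReal_nodeLaw_fst_eq (j : Fin r) : (nodeLaw μ K P).real {a | a.1 = j} = μ j := by
  have := h.isProbabilityMeasure_subsetLaw
  rw [← integral_ite_one_zero, integral_nodeLaw h.μ_nonneg]
  rw [Fintype.sum_eq_single j fun i hi => ?_]
  · simp
  · simp [hi]

theorem measureReal_card_class_lt_le (hn : 0 < n) {j : Fin r} (hj : 0 < μ j) :
    (modelMeasure n μ K P α).real {ω | (Finset.card {v | (ω.1 v).1 = j} : ℝ) < μ j / 2 * n} ≤
      4 / (μ j * n) := by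
  have := h.isProbabilityMeasure_nodeLaw
  have : Nonempty (Fin n) := ⟨⟨0, hn⟩⟩
  have hclass := h.measureReal_nodeLaw_fst_eq j
  have hpi := measureReal_pi_card_filter_lt_le (ι := Fin n) (nodeLaw μ K P) (hclass ▸ hj)
  rw [hclass, Fintype.card_fin] at hpi
  exact (measurePreserving_fst.measureReal_preimage
    (MeasurableSet.of_discrete.nullMeasurableSet)).trans_le hpi

theorem measureReal_not_connected_le (hn : 0 < n) {j : Fin r} (hj : 0 < μ j) (η : ℝ) :
    (modelMeasure n μ K P α).real {ω | ¬ (network ω).Connected} ≤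
      4 / (μ j * n) +
      ∑ S : Finset (Fin n) with S.Nonempty ∧ S.card ≤ η * n,
        (modelMeasure n μ K P α).real {ω | NoEdge (network ω) S Sᶜ} +
      ∑ A : Finset (Fin n) × Finset (Fin n) with
          Disjoint A.1 A.2 ∧ η * n ≤ A.1.card ∧ μ j / 4 * n ≤ A.2.card,
        (modelMeasure n μ K P α).real
          {ω | (∀ v ∈ A.2, (ω.1 v).1 = j) ∧ NoEdge (network ω) A.1 A.2} := by
  have := h.isProbabilityMeasure_modelMeasure (n := n) (α := α)
  have : Nonempty (Fin n) := ⟨⟨0, hn⟩⟩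
  let small : Finset (Finset (Fin n)) := {S | S.Nonempty ∧ S.card ≤ η * n}
  let large : Finset (Finset (Fin n) × Finset (Fin n)) :=
    {A | Disjoint A.1 A.2 ∧ η * n ≤ A.1.card ∧ μ j / 4 * n ≤ A.2.card}
  let few : Set (Sample n r P) := {ω | (Finset.card {v | (ω.1 v).1 = j} : ℝ) < μ j / 2 * n}
  let smallCut : Set (Sample n r P) := ⋃ S ∈ small, {ω | NoEdge (network ω) S Sᶜ}
  let largeCut : Set (Sample n r P) :=
    ⋃ A ∈ large, {ω | (∀ v ∈ A.2, (ω.1 v).1 = j) ∧ NoEdge (network ω) A.1 A.2}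
  have hsub : {ω : Sample n r P | ¬ (network ω).Connected} ⊆ few ∪ smallCut ∪ largeCut := by
    intro ω hω
    by_cases hfew : ω ∈ few
    · exact .inl (.inl hfew)
    have hmany : 2 * (μ j / 4 * n) ≤ (Finset.card {v | (ω.1 v).1 = j} : ℝ) := by
      have := not_lt.1 (show ¬ (Finset.card {v | (ω.1 v).1 = j} : ℝ) < μ j / 2 * n from hfew)
      linarith
    rcases exists_noEdge_of_not_connected hω {v | (ω.1 v).1 = j} (s := η * n)
      hmany with ⟨S, hS, hcut⟩ | ⟨A, hA, hclass, hcut⟩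
    · exact .inl (.inr (Set.mem_biUnion ((Finset.mem_filter_univ _).2 hS) hcut))
    · exact .inr (Set.mem_biUnion ((Finset.mem_filter_univ _).2 hA) ⟨by simpa using hclass, hcut⟩)
  calc _ ≤ (modelMeasure n μ K P α).real (few ∪ smallCut ∪ largeCut) := measureReal_mono hsub
    _ ≤ (modelMeasure n μ K P α).real few + (modelMeasure n μ K P α).real smallCut +
          (modelMeasure n μ K P α).real largeCut :=
        (measureReal_union_le _ _).trans (by gcongr; exact measureReal_union_le _ _)
    _ ≤ _ := by
        gcongr
        · exact h.measureReal_card_class_lt_le hn hj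
        · exact measureReal_biUnion_finset_le _ _
        · exact measureReal_biUnion_finset_le _ _

end Admissible

theorem sum_nonempty_pow_card_le {ι : Type*} [Fintype ι] {b : ℝ} (hb : 0 ≤ b) :
    ∑ S : Finset ι with S.Nonempty, b ^ S.card ≤ Real.exp (Fintype.card ι * b) - 1 := by
  classical
  have hsum : ∑ S : Finset ι, b ^ S.card = (b + 1) ^ Fintype.card ι := by
    simpa using Fintype.sum_pow_mul_eq_add_pow ι b (1 : ℝ)
  have hexp : (b + 1) ^ Fintype.card ι ≤ Real.exp (Fintype.card ι * b) := by
    rw [Real.exp_nat_mul]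
    exact pow_le_pow_left₀ (by positivity) (Real.add_one_le_exp b) _
  have herase : ({S | S.Nonempty} : Finset (Finset ι)) = Finset.univ.erase ∅ := by
    ext S
    simp [Finset.nonempty_iff_ne_empty]
  rw [herase, Finset.sum_erase_eq_sub (Finset.mem_univ ∅), hsum]
  simpa using hexp

theorem sum_inv_choose_card (n : ℕ) :
    ∑ S : Finset (Fin n), (n.choose S.card : ℝ)⁻¹ = n + 1 := by
  rw [← Finset.powerset_univ, Finset.sum_powerset_apply_card fun m => (n.choose m : ℝ)⁻¹,
    Finset.card_univ, Fintype.card_fin]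
  calc _ = ∑ _ ∈ Finset.range (n + 1), (1 : ℝ) := by
        refine Finset.sum_congr rfl fun m hm => ?_
        have hpos := Nat.choose_pos (Nat.lt_succ_iff.1 (Finset.mem_range.1 hm))
        rw [nsmul_eq_mul, mul_inv_cancel₀ (by positivity)]
    _ = _ := by simp

theorem choose_le_exp {n m : ℕ} (hm : 0 < m) (hmn : m ≤ n) :
    (n.choose m : ℝ) ≤ Real.exp (m * (1 + Real.log (n / m))) := by
  have hn : 0 < n := hm.trans_le hmn
  rw [Real.exp_nat_mul, Real.exp_add, Real.exp_log (by positivity), mul_pow, ← Real.exp_nat_mul,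
    mul_one]
  calc (n.choose m : ℝ) ≤ n ^ m / m.factorial := Nat.choose_le_pow_div m n
    _ = ((m : ℝ) ^ m / m.factorial) * (n / m) ^ m := by rw [div_pow]; field_simp
    _ ≤ _ := by
      gcongr
      exact Real.pow_div_factorial_le_exp _ m.cast_nonneg m

theorem mul_one_add_log_inv_le {y : ℝ} (hy : 0 < y) :
    y * (1 + Real.log y⁻¹) ≤ 2 * √y := by
  have := Real.sqrt_pos.2 hy
  have hlog : Real.log y⁻¹ = 2 * Real.log (√y)⁻¹ := by
    rw [Real.log_inv, Real.log_inv, Real.log_sqrt hy.le]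
    ring
  calc y * (1 + Real.log y⁻¹) ≤ y * (1 + 2 * ((√y)⁻¹ - 1)) := by
        rw [hlog]
        gcongr
        exact Real.log_le_sub_one_of_pos (by positivity)
    _ = 2 * √y - y := by
        nth_rewrite 1 [← Real.mul_self_sqrt hy.le]
        field_simp
        linear_combination -Real.mul_self_sqrt hy.le
    _ ≤ _ := sub_le_self _ hy.le

theorem two_le_exp_one : 2 ≤ Real.exp 1 := by linarith [Real.add_one_le_exp (1 : ℝ)]

theorem two_pow_le_exp (n : ℕ) : (2 : ℝ) ^ n ≤ Real.exp n := by
  rw [← mul_one (n : ℝ), Real.exp_nat_mul]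
  exact pow_le_pow_left₀ zero_le_two two_le_exp_one n

theorem two_pow_mul_pow_pow_le {z : ℝ} (hz₀ : 0 ≤ z) (hz₁ : z ≤ 1) {m q k s : ℕ}
    (hs : m ≤ q * s) : 2 ^ m * (z ^ (q * k)) ^ s ≤ (2 * z ^ k) ^ m := by
  rw [mul_pow, ← pow_mul, ← pow_mul]
  gcongr 2 ^ m * ?_
  refine pow_le_pow_of_le_one hz₀ hz₁ ?_
  calc k * m ≤ k * (q * s) := Nat.mul_le_mul_left k hs
    _ = q * k * s := by ring

theorem le_mul_add_one_sub_ceil {q : ℕ} (hq : 0 < q) (m : ℕ) :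
    m ≤ q * (m + 1 - ⌈(1 - 1 / (q : ℝ)) * m⌉₊) := by
  have hq' : (1 : ℝ) ≤ q := by exact_mod_cast hq
  have hle : 0 ≤ 1 - 1 / (q : ℝ) := by
    rw [sub_nonneg, div_le_one (by positivity)]
    exact hq'
  have hceil := Nat.ceil_lt_add_one (mul_nonneg hle m.cast_nonneg)
  have hsub := Nat.sub_le_iff_le_add.1 (le_refl (m + 1 - ⌈(1 - 1 / (q : ℝ)) * m⌉₊))
  have hsub' : (m : ℝ) + 1 ≤ (m + 1 - ⌈(1 - 1 / (q : ℝ)) * m⌉₊ : ℕ) +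
      ⌈(1 - 1 / (q : ℝ)) * m⌉₊ := by exact_mod_cast hsub
  have hdiv : (m : ℝ) / q ≤ (m + 1 - ⌈(1 - 1 / (q : ℝ)) * m⌉₊ : ℕ) := by
    linarith [show (1 - 1 / (q : ℝ)) * m = m - m / q by ring]
  rw [div_le_iff₀' (by positivity)] at hdiv
  exact_mod_cast hdiv

theorem exists_nat_mul_mem_Icc {x ε : ℝ} (hx : 0 < x) (hxε : x ≤ ε) :
    ∃ t : ℕ, t * x ∈ Set.Icc (2 * ε) (3 * ε) := by
  have hceil := Nat.ceil_lt_add_one (a := 2 * ε / x) (by have := hx.trans_le hxε; positivity)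
  refine ⟨⌈2 * ε / x⌉₊, (div_le_iff₀ hx).1 (Nat.le_ceil _), ?_⟩
  calc _ ≤ (2 * ε / x + 1) * x := by gcongr
    _ = 2 * ε + x := by field_simp
    _ ≤ 3 * ε := by linarith

theorem tendsto_log_nat : Tendsto (fun n : ℕ => Real.log n) atTop atTop :=
  Real.tendsto_log_atTop.comp tendsto_natCast_atTop_atTop

theorem eventually_mul_log_le_exp (C : ℝ) {a : ℝ} (ha : 0 < a) :
    ∀ᶠ n : ℕ in atTop, C * Real.log n ≤ Real.exp (a * Real.log n) := by
  filter_upwards [tendsto_log_nat.eventually_ge_atTop 0,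
    tendsto_log_nat.eventually_ge_atTop (2 * C / a ^ 2)] with n hlog hC
  rw [div_le_iff₀ (by positivity)] at hC
  have hexp := Real.quadratic_le_exp_of_nonneg (x := a * Real.log n) (by positivity)
  nlinarith [mul_nonneg ha.le hlog, mul_le_mul_of_nonneg_right hC hlog]

theorem tendsto_mul_exp_neg_mul_log {a : ℝ} (ha : 1 < a) :
    Tendsto (fun n : ℕ => (n : ℝ) * Real.exp (-(a * Real.log n))) atTop (𝓝 0) := by
  have hexp : Tendsto (fun n : ℕ => Real.exp ((1 - a) * Real.log n)) atTop (𝓝 0) :=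
    Real.tendsto_exp_atBot.comp (tendsto_log_nat.const_mul_atTop_of_neg (by linarith))
  refine hexp.congr' ?_
  filter_upwards [eventually_gt_atTop 0] with n hn
  rw [sub_mul, sub_eq_add_neg, Real.exp_add, one_mul, Real.exp_log (by positivity)]

theorem exists_one_lt_loss_mul {c : ℝ} (hc : 1 < c) :
    ∃ q : ℕ, 4 ≤ q ∧ 1 < (1 - 4 / (q : ℝ)) * (1 - 1 / (q : ℝ)) ^ 2 * c := by
  have hlim : Tendsto (fun q : ℕ => (1 - 4 / (q : ℝ)) * (1 - 1 / (q : ℝ)) ^ 2 * c) atTop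
      (𝓝 ((1 - 0) * (1 - 0) ^ 2 * c)) :=
    (((tendsto_const_div_atTop_nhds_zero_nat 4).const_sub 1).mul
      (((tendsto_const_div_atTop_nhds_zero_nat 1).const_sub 1).pow 2)).mul_const c
  obtain ⟨q, hq, hq4⟩ := ((hlim.eventually (lt_mem_nhds (by simpa using hc))).and
    (eventually_ge_atTop 4)).exists
  exact ⟨q, hq4, hq⟩

theorem cast_card_compl {n : ℕ} (S : Finset (Fin n)) : (Sᶜ.card : ℝ) = n - S.card := by
  rw [Finset.card_compl, Fintype.card_fin, Nat.cast_sub (by simpa using S.card_le_univ)]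

theorem choose_mul_add_exp_neg_le {n m r : ℕ} (hm : 0 < m) (hmn : m ≤ n) {c : ℝ} (hc : 0 ≤ c)
    (hcm : 12 * c * (m / n) ≤ 1) :
    n.choose m * (r * (2 * c * (m / n) ^ 2) ^ m + Real.exp (-(2 * (m * (1 + Real.log (n / m)))))) ≤
      (r + 1) * (1 / 2) ^ m := by
  have hn : 0 < n := hm.trans_le hmn
  set H := 1 + Real.log (n / m) with hH
  have hH₁ : 1 ≤ H := le_add_of_nonneg_right
    (Real.log_nonneg ((one_le_div (by positivity)).2 (by exact_mod_cast hmn)))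
  have hexp : Real.exp (m * H) = (Real.exp 1 * (n / m)) ^ m := by
    rw [hH, Real.exp_nat_mul, Real.exp_add, Real.exp_log (by positivity)]
  calc _ ≤ Real.exp (m * H) * (r * (2 * c * (m / n) ^ 2) ^ m + Real.exp (-(2 * (m * H)))) := by
        gcongr
        exact choose_le_exp hm hmn
    _ = r * (Real.exp 1 * (2 * c * (m / n))) ^ m + Real.exp (-(m * H)) := by
      rw [mul_add, ← Real.exp_add, hexp, mul_left_comm, ← mul_pow]
      congr 3
      · field_simp
      · ring
    _ ≤ r * (1 / 2) ^ m + (1 / 2) ^ m := by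
      gcongr
      · have : 0 ≤ 2 * c * (m / n) := by positivity
        nlinarith [Real.exp_one_lt_three]
      · calc Real.exp (-(m * H)) ≤ Real.exp (-(m : ℝ)) := by
              rw [Real.exp_le_exp, neg_le_neg_iff]
              exact le_mul_of_one_le_right m.cast_nonneg hH₁
          _ ≤ _ := by
            rw [Real.exp_neg, one_div, inv_pow]
            exact inv_anti₀ (by positivity) (two_pow_le_exp m)
    _ = _ := by ring

theorem sq_mul_le_sub_mul_ceil_mul {κ a : ℝ} {m n : ℕ} (hκ : 0 ≤ κ) (ha : 0 ≤ a)
    (hm : m ≤ (1 - κ) * n) : κ ^ 2 * a * m * n ≤ (n - m) * (⌈κ * m⌉₊ * a) := by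
  have hsub : κ * n ≤ n - m := by linarith
  have hceil : κ * m ≤ ⌈κ * m⌉₊ := Nat.le_ceil _
  have hsub₀ : 0 ≤ (n : ℝ) - m := le_trans (by positivity) hsub
  calc κ ^ 2 * a * m * n = κ * n * (κ * m * a) := by ring
    _ ≤ _ := mul_le_mul hsub (by gcongr) (by positivity) hsub₀

theorem mul_sqrt_le_one {C y : ℝ} (hC : 1 ≤ C) (h : C ^ 2 * y ≤ 1) :
    C * √y ≤ 1 := by
  rwa [← Real.sqrt_sq (zero_le_one.trans hC), ← Real.sqrt_mul (sq_nonneg _), Real.sqrt_le_one]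

theorem half_le_add_one_sub_ceil {a b : ℝ} {s : ℕ} (ha : 0 ≤ a) (hab : a ≤ b / 2) (hs : b ≤ s) :
    b / 2 ≤ (s + 1 - ⌈a⌉₊ : ℕ) := by
  have hsub : (s : ℝ) + 1 ≤ (s + 1 - ⌈a⌉₊ : ℕ) + ⌈a⌉₊ := by
    exact_mod_cast Nat.sub_le_iff_le_add.1 le_rfl
  linarith [Nat.ceil_lt_add_one ha]

theorem two_pow_mul_pow_le_exp_neg {η ρ : ℝ} {n s k : ℕ} (hη : 0 < η) (hρ₀ : 0 ≤ ρ)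
    (hρ : ρ ≤ Real.exp (-(8 / η))) (hs : s ≤ n) (hk : η * n / 2 ≤ k) :
    2 ^ s * ρ ^ k ≤ Real.exp (-(3 * n)) := by
  calc 2 ^ s * ρ ^ k ≤ Real.exp n * Real.exp (-(8 / η)) ^ k := by
        gcongr
        exact (two_pow_le_exp s).trans (Real.exp_le_exp.2 (by exact_mod_cast hs))
    _ ≤ Real.exp n * Real.exp (-(4 * n)) := by
      rw [← Real.exp_nat_mul, mul_neg]
      gcongr Real.exp n * Real.exp (-?_)
      calc 4 * (n : ℝ) = η * n / 2 * (8 / η) := by field_simp; ring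
        _ ≤ _ := by gcongr
    _ = _ := by rw [← Real.exp_add]; ring_nf

namespace Admissible

variable {n r P : ℕ} [NeZero r] {μ : Fin r → ℝ} {K : Fin r → ℕ} {α : unitInterval} {μ₀ : ℝ}
  (h : Admissible μ K P)
include h

theorem measureReal_noEdge_compl_le_of_small (hα : 0 < (α : ℝ)) (hμ₀ : 0 < μ₀)
    (hμ : ∀ i, μ₀ ≤ μ i) (hn : 0 < n) {q : ℕ} (hq : 4 ≤ q) (hK : q * (q * 128) ≤ K 0)
    {ℓ c₁ c₂ : ℝ} (hqℓ : 32 * Real.log q ≤ ℓ)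
    (hlo : c₁ * (ℓ / n) ≤ edgeProb μ K P α) (hhi : edgeProb μ K P α ≤ c₂ * (ℓ / n))
    (hexp : 3 * q ^ 2 * c₂ / μ₀ * ℓ ≤ Real.exp (1 / 64 * ℓ)) {S : Finset (Fin n)}
    (hS : S.card ≤ n * Real.exp (-(ℓ / 32))) :
    (modelMeasure n μ K P α).real {ω | NoEdge (network ω) S Sᶜ} ≤
      r * (2 * Real.exp (-(2 * ℓ))) ^ S.card +
        Real.exp (-((1 - 4 / (q : ℝ)) * (1 - 1 / (q : ℝ)) ^ 2 * c₁ * ℓ)) ^ S.card := by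
  have hq' : (4 : ℝ) ≤ q := by exact_mod_cast hq
  have hn' : (0 : ℝ) < n := by exact_mod_cast hn
  have hℓ : 0 ≤ ℓ := (mul_nonneg (by norm_num) (Real.log_nonneg (by linarith))).trans hqℓ
  have hκ₁ : 0 ≤ 1 - 1 / (q : ℝ) := by rw [sub_nonneg, div_le_one] <;> linarith
  have hκ₄ : 0 ≤ 1 - 4 / (q : ℝ) := by rw [sub_nonneg, div_le_one] <;> linarith
  set Λ := edgeProb μ K P α
  set m := S.card
  let t := ⌈(1 - 1 / (q : ℝ)) * m⌉₊
  have htm : t ≤ m := Nat.ceil_le.2 (mul_le_of_le_one_left m.cast_nonneg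
    (sub_le_self _ (by positivity)))
  have hΛ : 0 ≤ Λ := h.edgeProb_nonneg
  have hx : t * (Λ / μ₀) ≤ m * (Λ / μ₀) := by gcongr
  have hz : 3 * ((q : ℝ) ^ 2 * (m * (Λ / μ₀))) ≤ Real.exp (-(1 / 64 * ℓ)) := by
    calc _ ≤ 3 * ((q : ℝ) ^ 2 * (n * Real.exp (-(ℓ / 32)) * (c₂ * (ℓ / n) / μ₀))) := by gcongr
      _ = 3 * q ^ 2 * c₂ / μ₀ * ℓ * Real.exp (-(ℓ / 32)) := by field_simp
      _ ≤ Real.exp (1 / 64 * ℓ) * Real.exp (-(ℓ / 32)) := by gcongr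
      _ = _ := by rw [← Real.exp_add]; ring_nf
  have hz₀ : 0 ≤ 3 * ((q : ℝ) ^ 2 * (m * (Λ / μ₀))) := by positivity
  have hz₁ := hz.trans (Real.exp_le_one_iff.2 (by linarith))
  refine (h.measureReal_noEdge_le hα hμ₀ hμ (L := q * 128) (by linarith) (by exact_mod_cast hK)
    hx hz₁ disjoint_compl_right).trans (add_le_add ?_ ?_)
  · gcongr r * ?_
    refine (two_pow_mul_pow_pow_le hz₀ hz₁ (le_mul_add_one_sub_ceil (by omega) m)).trans ?_
    calc _ ≤ (2 * Real.exp (-(1 / 64 * ℓ)) ^ 128) ^ m := by gcongr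
      _ = _ := by rw [← Real.exp_nat_mul]; ring_nf
  · rw [← Real.exp_nat_mul, Real.exp_le_exp, mul_neg, neg_le_neg_iff, cast_card_compl]
    have hmn : (m : ℝ) ≤ (1 - (1 - 1 / q)) * n := by
      rw [sub_sub_cancel, mul_comm]
      refine hS.trans (mul_le_mul_of_nonneg_left ?_ hn'.le)
      rw [one_div, ← Real.exp_log (by linarith : (0 : ℝ) < q), ← Real.exp_neg, Real.exp_le_exp]
      linarith
    calc _ = (1 - 1 / (q : ℝ)) ^ 2 * ((1 - 4 / q) * (c₁ * (ℓ / n))) * m * n := by field_simp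
      _ ≤ (1 - 1 / (q : ℝ)) ^ 2 * ((1 - 4 / q) * Λ) * m * n := by gcongr
      _ ≤ _ := sq_mul_le_sub_mul_ceil_mul hκ₁ (mul_nonneg hκ₄ hΛ) hmn

theorem μ₀_le_one (hμ : ∀ i, μ₀ ≤ μ i) : μ₀ ≤ 1 := (hμ 0).trans (h.μ_le_one 0)

theorem measureReal_noEdge_compl_le_of_two_mul_le (hα : 0 < (α : ℝ)) (hμ₀ : 0 < μ₀)
    (hμ : ∀ i, μ₀ ≤ μ i) (hK : 64 ≤ K 0) {S : Finset (Fin n)} {t : ℕ} {x : ℝ}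
    (ht : 2 * t ≤ S.card) (hS : 2 * S.card ≤ n) (hx : t * (edgeProb μ K P α / μ₀) ≤ x)
    (hx₁ : 192 * x ≤ 1) :
    (modelMeasure n μ K P α).real {ω | NoEdge (network ω) S Sᶜ} ≤
      r * (2 * (192 * x) ^ 4) ^ S.card + Real.exp (-(n * (t * edgeProb μ K P α) / 4)) := by
  set Λ := edgeProb μ K P α
  have hΛ : 0 ≤ Λ := h.edgeProb_nonneg
  have hx₀ : 0 ≤ x := le_trans (by positivity) hx
  have hz : 3 * ((8 : ℝ) ^ 2 * x) = 192 * x := by ring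
  have hS' : 2 * (S.card : ℝ) ≤ n := by exact_mod_cast hS
  refine (h.measureReal_noEdge_le hα hμ₀ hμ (q := 8) (L := 2 * 4) (by norm_num)
    (by norm_num; exact_mod_cast hK) hx (hz.trans_le hx₁) disjoint_compl_right).trans
    (add_le_add ?_ ?_)
  · rw [hz]
    gcongr r * ?_
    exact two_pow_mul_pow_pow_le (by positivity) hx₁ (by lia)
  · rw [Real.exp_le_exp, neg_le_neg_iff, cast_card_compl]
    calc n * (t * Λ) / 4 = n / 2 * (t * ((1 - 4 / 8) * Λ)) := by ring
      _ ≤ (n - S.card) * (t * ((1 - 4 / 8) * Λ)) := by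
        gcongr
        linarith

theorem measureReal_noEdge_compl_le_of_medium (hα : 0 < (α : ℝ)) (hμ₀ : 0 < μ₀)
    (hμ : ∀ i, μ₀ ≤ μ i) (hK : 64 ≤ K 0) {S : Finset (Fin n)} (hS : S.Nonempty)
    (hSn : 12 * (4608 / μ₀) ^ 4 * (S.card / n) ≤ 1) (hΛ : 0 < edgeProb μ K P α)
    (hΛS : edgeProb μ K P α ≤ 4 * (S.card / n * (1 + Real.log (n / S.card))))
    (hlog : 24 * (1 + Real.log (n / S.card)) ≤ n * edgeProb μ K P α) :
    (modelMeasure n μ K P α).real {ω | NoEdge (network ω) S Sᶜ} ≤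
      r * (2 * (4608 / μ₀) ^ 4 * (S.card / n) ^ 2) ^ S.card +
        Real.exp (-(2 * (S.card * (1 + Real.log (n / S.card))))) := by
  have hC : 1 ≤ 4608 / μ₀ := by
    rw [one_le_div hμ₀]
    linarith [h.μ₀_le_one hμ]
  obtain ⟨t, hlo, hhi⟩ := exists_nat_mul_mem_Icc hΛ hΛS
  set Λ := edgeProb μ K P α
  set m := S.card
  set y : ℝ := m / n with hy
  set H := 1 + Real.log (n / m) with hH
  have hm : (0 : ℝ) < m := by exact_mod_cast hS.card_pos
  have hn : (0 : ℝ) < n := by exact_mod_cast hS.card_pos.trans_le (by simpa using S.card_le_univ)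
  have hy₀ : 0 < y := by positivity
  have hyH : y * H ≤ 2 * √y := by
    rw [hH, ← inv_div (m : ℝ)]
    exact mul_one_add_log_inv_le hy₀
  have hx : t * (Λ / μ₀) ≤ 24 * √y / μ₀ := by
    rw [← mul_div_assoc]
    exact div_le_div_of_nonneg_right (by linarith) hμ₀.le
  have hCx : 192 * (24 * √y / μ₀) = 4608 / μ₀ * √y := by ring
  have hC₂ : (4608 / μ₀) ^ 2 * y ≤ 1 := (mul_le_mul_of_nonneg_right
    (by nlinarith [one_le_pow₀ hC (n := 2)]) hy₀.le).trans hSn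
  have htm : 2 * t ≤ m := by
    have : 2 * t * Λ ≤ m * Λ := by
      calc 2 * t * Λ ≤ y * (24 * H) := by linarith
        _ ≤ y * (n * Λ) := by gcongr
        _ = m * Λ := by rw [hy]; field_simp
    exact_mod_cast le_of_mul_le_mul_right this hΛ
  have hmn : 2 * (m : ℝ) ≤ n := by
    have : 2 * y ≤ 1 := (mul_le_mul_of_nonneg_right
      (by linarith [one_le_pow₀ hC (n := 4)]) hy₀.le).trans hSn
    rwa [hy, mul_div_assoc', div_le_one hn] at this
  refine (h.measureReal_noEdge_compl_le_of_two_mul_le hα hμ₀ hμ hK htm (by exact_mod_cast hmn) hx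
    (hCx.trans_le (mul_sqrt_le_one hC hC₂))).trans (add_le_add (le_of_eq ?_) ?_)
  · rw [hCx, mul_pow (4608 / μ₀), show √y ^ 4 = (√y ^ 2) ^ 2 by ring, Real.sq_sqrt hy₀.le,
      mul_assoc]
  · rw [Real.exp_le_exp, neg_le_neg_iff]
    calc 2 * (m * H) = n * (8 * (y * H)) / 4 := by rw [hy]; field_simp; ring
      _ ≤ n * (t * Λ) / 4 := by gcongr n * ?_ / 4; linarith

theorem measureReal_noEdge_and_class_eq_le_exp (hα : 0 < (α : ℝ)) (hμ₀ : 0 < μ₀)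
    (hμ : ∀ i, μ₀ ≤ μ i) {η d : ℝ} (hη : 0 < η) (hd : d = Real.exp (-(12 / μ₀)))
    (hK : 4 * Real.exp (8 / η) / d ^ 2 ≤ K 0) (hn : 0 < n)
    (hΛ : 16 / (d ^ 2 * η) ≤ n * edgeProb μ K P α) {j : Fin r}
    (hj : edgeProb μ K P α ≤ α * shareProb P (K 0) (K j)) {S T : Finset (Fin n)}
    (hST : Disjoint S T) (hS : η * n ≤ S.card) (hT : μ j / 4 * n ≤ T.card) :
    (modelMeasure n μ K P α).real {ω | (∀ v ∈ T, (ω.1 v).1 = j) ∧ NoEdge (network ω) S T} ≤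
      2 * Real.exp (-(3 * n)) := by
  set Λ := edgeProb μ K P α
  have hd₀ : 0 < d := hd ▸ Real.exp_pos _
  have hK₀ : (0 : ℝ) < K 0 := by exact_mod_cast h.K_zero_pos
  have hn' : (0 : ℝ) < n := by exact_mod_cast hn
  have hΛ₀ : 0 < Λ := by
    by_contra! hneg
    have : 0 < 16 / (d ^ 2 * η) := by positivity
    nlinarith
  set t := ⌈8 / (d ^ 2 * Λ)⌉₊
  have ht : 1 ≤ d + t * ((α : ℝ) * (d ^ 2 / 8 * shareProb P (K 0) (K j))) := by
    have hceil : 8 / (d ^ 2 * Λ) ≤ t := Nat.le_ceil _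
    rw [div_le_iff₀ (by positivity)] at hceil
    calc 1 ≤ t * (d ^ 2 / 8 * Λ) := by linarith
      _ ≤ t * (d ^ 2 / 8 * (α * shareProb P (K 0) (K j))) := by gcongr
      _ ≤ _ := by linarith
  have hs : η * n / 2 ≤ (S.card + 1 - t : ℕ) := by
    refine half_le_add_one_sub_ceil (by positivity) ?_ hS
    rw [div_le_iff₀ (by positivity)] at hΛ ⊢
    linarith
  have hρ : 4 / (K 0 * d ^ 2) ≤ Real.exp (-(8 / η)) := by
    rw [div_le_iff₀ (by positivity)] at hK
    rwa [Real.exp_neg, div_le_iff₀ (by positivity), ← div_eq_inv_mul, le_div_iff₀ (Real.exp_pos _)]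
  refine (h.measureReal_noEdge_and_class_eq_le hα hd₀ j ht (hρ.trans (Real.exp_le_one_iff.2
    (neg_nonpos.2 (by positivity)))) hST).trans ?_
  rw [two_mul]
  refine add_le_add ?_ ?_
  · exact two_pow_mul_pow_le_exp_neg hη (by positivity) hρ (by simpa using S.card_le_univ) hs
  · rw [hd, ← Real.exp_nat_mul, Real.exp_le_exp, mul_neg, neg_le_neg_iff]
    calc 3 * (n : ℝ) = μ₀ / 4 * n * (12 / μ₀) := by field_simp; norm_num
      _ ≤ μ j / 4 * n * (12 / μ₀) := by gcongr; exact hμ j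
      _ ≤ _ := by gcongr

end Admissible

theorem exp_mul_log_le_of_mul_exp_le {n m : ℕ} (hn : 0 < n)
    (h : n * Real.exp (-(Real.log n / 32)) ≤ m) : Real.exp (31 / 32 * Real.log n) ≤ m := by
  refine le_trans (le_of_eq ?_) h
  nth_rw 2 [← Real.exp_log (by positivity : (0 : ℝ) < n)]
  rw [← Real.exp_add]
  ring_nf

theorem half_pow_le_exp_neg (m : ℕ) : (1 / 2 : ℝ) ^ m ≤ Real.exp (-(m / 2)) := by
  calc (1 / 2 : ℝ) ^ m ≤ Real.exp (-(1 / 2)) ^ m := by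
        gcongr
        linarith [Real.add_one_le_exp (-(1 / 2) : ℝ)]
    _ = _ := by rw [← Real.exp_nat_mul]; ring_nf

section AboveThreshold

variable {r : ℕ} [NeZero r] {μ : Fin r → ℝ} {Θ : Scaling r} {μ₀ c₁ c₂ : ℝ}
  (hμ₀ : 0 < μ₀) (hμ : ∀ i, μ₀ ≤ μ i) (hadm : ∀ᶠ n in atTop, Admissible μ (Θ.K n) (Θ.P n))
  (hlo : ∀ᶠ n : ℕ in atTop, c₁ * (Real.log n / n) ≤ Θ.meanEdge μ n 0)
  (hhi : ∀ᶠ n : ℕ in atTop, Θ.meanEdge μ n 0 ≤ c₂ * (Real.log n / n))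
  (hK : Tendsto (fun n => Θ.K n 0) atTop atTop) (hc₁ : 1 < c₁)

include hlo hc₁ in
theorem eventually_log_le_mul_meanEdge :
    ∀ᶠ n : ℕ in atTop, Real.log n ≤ n * Θ.meanEdge μ n 0 := by
  filter_upwards [hlo, eventually_gt_atTop 0, tendsto_log_nat.eventually_ge_atTop 0]
    with n hlo hn hlog
  calc Real.log n ≤ c₁ * Real.log n := le_mul_of_one_le_left hlog hc₁.le
    _ = n * (c₁ * (Real.log n / n)) := by field_simp
    _ ≤ _ := by gcongr

include hμ₀ hμ hadm hlo hK hc₁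

include hhi in
theorem exists_eventually_small_cut_le :
    ∃ θ : ℝ, 1 < θ ∧ ∀ᶠ n : ℕ in atTop, ∀ S : Finset (Fin n),
      S.card ≤ n * Real.exp (-(Real.log n / 32)) →
      Θ.prob μ n (fun G => NoEdge G S Sᶜ) ≤
        r * (2 * Real.exp (-(2 * Real.log n))) ^ S.card +
          Real.exp (-(θ * Real.log n)) ^ S.card := by
  obtain ⟨q, hq, hθ⟩ := exists_one_lt_loss_mul hc₁
  refine ⟨_, hθ, ?_⟩
  filter_upwards [hadm, hlo, hhi, hK.eventually_ge_atTop (q * (q * 128)), eventually_gt_atTop 0,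
    eventually_mul_log_le_exp (3 * q ^ 2 * c₂ / μ₀) (by norm_num : (0 : ℝ) < 1 / 64),
    tendsto_log_nat.eventually_ge_atTop (32 * Real.log q)] with n h hlo hhi hK hn hexp hlog S hS
  exact h.measureReal_noEdge_compl_le_of_small (Θ.α_pos n) hμ₀ hμ hn hq hK hlog hlo
    hhi hexp hS

include hhi in
theorem exists_eventually_medium_cut_le :
    ∃ η : ℝ, 0 < η ∧ ∀ᶠ n : ℕ in atTop, ∀ S : Finset (Fin n),
      n * Real.exp (-(Real.log n / 32)) ≤ S.card → S.card ≤ η * n →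
      Θ.prob μ n (fun G => NoEdge G S Sᶜ) ≤
        (r + 1) * Real.exp (-(2 * Real.log n)) * (n.choose S.card : ℝ)⁻¹ := by
  refine ⟨1 / (12 * (4608 / μ₀) ^ 4), by positivity, ?_⟩
  filter_upwards [hadm, eventually_log_le_mul_meanEdge hlo hc₁, hhi, hK.eventually_ge_atTop 64,
    eventually_gt_atTop 0, tendsto_log_nat.eventually_ge_atTop 96,
    eventually_mul_log_le_exp 4 (by norm_num : (0 : ℝ) < 31 / 32),
    eventually_mul_log_le_exp c₂ (by norm_num : (0 : ℝ) < 31 / 32)]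
    with n h hΛ hhi hK hn hlog hexp₄ hexp₂ S hS hSη
  have hSexp := exp_mul_log_le_of_mul_exp_le hn hS
  set m := S.card
  have hn' : (0 : ℝ) < n := by exact_mod_cast hn
  have hm : (0 : ℝ) < m := (Real.exp_pos _).trans_le hSexp
  have hmn : m ≤ n := by simpa using S.card_le_univ
  have hSne : S.Nonempty := Finset.card_pos.1 (by exact_mod_cast hm)
  have hlog₀ : 0 ≤ Real.log (n / m) :=
    Real.log_nonneg ((one_le_div hm).2 (by exact_mod_cast hmn))
  have hlog₁ : Real.log (n / m) ≤ Real.log n / 32 := by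
    rw [Real.log_div hn'.ne' hm.ne']
    linarith [(Real.le_log_iff_exp_le hm).2 hSexp]
  have hΛ₀ : 0 < Θ.meanEdge μ n 0 := pos_of_mul_pos_right (by linarith) hn'.le
  have hy : 12 * (4608 / μ₀) ^ 4 * (m / n) ≤ 1 := by
    rw [mul_div_assoc', div_le_one hn']
    rw [div_mul_eq_mul_div, one_mul, le_div_iff₀ (by positivity)] at hSη
    linarith
  have hΛS : Θ.meanEdge μ n 0 ≤ 4 * (m / n * (1 + Real.log (n / m))) := by
    calc _ ≤ c₂ * Real.log n / n := by rwa [mul_div_assoc]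
      _ ≤ m / n := by gcongr; exact hexp₂.trans hSexp
      _ ≤ 4 * (m / n * 1) := by linarith [div_pos hm hn']
      _ ≤ _ := by gcongr; linarith
  have hhalf : (1 / 2 : ℝ) ^ m ≤ Real.exp (-(2 * Real.log n)) :=
    (half_pow_le_exp_neg m).trans <| Real.exp_le_exp.2 <| by
      linarith [Real.add_one_le_exp (31 / 32 * Real.log n)]
  have hcut := h.measureReal_noEdge_compl_le_of_medium (Θ.α_pos n) hμ₀ hμ hK hSne hy hΛ₀ hΛS
    (by change _ ≤ n * Θ.meanEdge μ n 0; linarith)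
  rw [← div_eq_mul_inv, le_div_iff₀' (by exact_mod_cast Nat.choose_pos hmn)]
  calc _ ≤ _ := mul_le_mul_of_nonneg_left hcut (Nat.cast_nonneg _)
    _ ≤ (r + 1) * (1 / 2) ^ m := choose_mul_add_exp_neg_le hSne.card_pos hmn (by positivity) hy
    _ ≤ _ := by gcongr

theorem eventually_large_cut_le {η : ℝ} (hη : 0 < η) :
    ∀ᶠ n : ℕ in atTop, ∀ j : Fin r, Θ.meanEdge μ n 0 ≤ Θ.α n * Θ.p n 0 j →
      ∀ S T : Finset (Fin n), Disjoint S T → η * n ≤ S.card → μ j / 4 * n ≤ T.card →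
      (modelMeasure n μ (Θ.K n) (Θ.P n) (Θ.α n)).real
        {ω | (∀ v ∈ T, (ω.1 v).1 = j) ∧ NoEdge (network ω) S T} ≤ 2 * Real.exp (-(3 * n)) := by
  set d : ℝ := Real.exp (-(12 / μ₀)) with hd
  filter_upwards [hadm, eventually_log_le_mul_meanEdge hlo hc₁, eventually_gt_atTop 0,
    (tendsto_natCast_atTop_atTop.comp hK).eventually_ge_atTop (4 * Real.exp (8 / η) / d ^ 2),
    tendsto_log_nat.eventually_ge_atTop (16 / (d ^ 2 * η))]
    with n h hΛ hn hK hlog j hj S T hST hS hT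
  exact h.measureReal_noEdge_and_class_eq_le_exp (Θ.α_pos n) hμ₀ hμ hη hd hK hn (hlog.trans hΛ)
    hj hST hS hT

end AboveThreshold

theorem sum_small_le {n : ℕ} {η a b₁ b₂ b₃ : ℝ} (ha : 0 ≤ a) (h₁ : 0 ≤ b₁) (h₂ : 0 ≤ b₂)
    (h₃ : 0 ≤ b₃) {f : Finset (Fin n) → ℝ} (hf : ∀ S : Finset (Fin n), S.Nonempty →
      S.card ≤ η * n → f S ≤ a * b₁ ^ S.card + b₂ ^ S.card + b₃ * (n.choose S.card : ℝ)⁻¹) :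
    ∑ S : Finset (Fin n) with S.Nonempty ∧ S.card ≤ η * n, f S ≤
      a * (Real.exp (n * b₁) - 1) + (Real.exp (n * b₂) - 1) + b₃ * (n + 1) := by
  have hmono : ∀ g : Finset (Fin n) → ℝ, (∀ S, 0 ≤ g S) →
      ∑ S : Finset (Fin n) with S.Nonempty ∧ S.card ≤ η * n, g S ≤
        ∑ S : Finset (Fin n) with S.Nonempty, g S := fun g hg =>
    Finset.sum_le_sum_of_subset_of_nonneg
      (Finset.monotone_filter_right _ fun _ _ hS => hS.1) fun S _ _ => hg S
  have hpow : ∀ {b : ℝ}, 0 ≤ b →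
      ∑ S : Finset (Fin n) with S.Nonempty ∧ S.card ≤ η * n, b ^ S.card ≤ Real.exp (n * b) - 1 :=
    fun hb => by
      simpa using (hmono _ fun S => pow_nonneg hb _).trans (sum_nonempty_pow_card_le hb)
  calc _ ≤ ∑ S : Finset (Fin n) with S.Nonempty ∧ S.card ≤ η * n,
        (a * b₁ ^ S.card + b₂ ^ S.card + b₃ * (n.choose S.card : ℝ)⁻¹) :=
        Finset.sum_le_sum fun S hS => hf S (Finset.mem_filter.1 hS).2.1 (Finset.mem_filter.1 hS).2.2
    _ ≤ _ := by
      rw [Finset.sum_add_distrib, Finset.sum_add_distrib, ← Finset.mul_sum, ← Finset.mul_sum,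
        ← sum_inv_choose_card]
      gcongr
      · exact hpow h₁
      · exact hpow h₂
      · exact Finset.subset_univ _

theorem sum_pairs_le {n : ℕ} {F : Finset (Finset (Fin n) × Finset (Fin n))}
    {f : Finset (Fin n) × Finset (Fin n) → ℝ} {c : ℝ} (hc : 0 ≤ c) (hf : ∀ A ∈ F, f A ≤ c) :
    ∑ A ∈ F, f A ≤ Real.exp (2 * n) * c := by
  have hcard : (F.card : ℝ) ≤ Real.exp (2 * n) := by
    calc (F.card : ℝ) ≤ 2 ^ n * 2 ^ n := by
          exact_mod_cast F.card_le_univ.trans_eq (by simp)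
      _ ≤ Real.exp n * Real.exp n := by gcongr <;> exact two_pow_le_exp n
      _ = _ := by rw [← Real.exp_add, two_mul]
  calc _ ≤ F.card • c := Finset.sum_le_card_nsmul F f c hf
    _ ≤ _ := by rw [nsmul_eq_mul]; gcongr

theorem tendsto_cut_bound (a : ℝ) {θ b : ℝ} (hθ : 1 < θ) (hb : 0 < b) :
    Tendsto (fun n : ℕ => 4 / (b * n) +
      (a * (Real.exp (n * (2 * Real.exp (-(2 * Real.log n)))) - 1) +
        (Real.exp (n * Real.exp (-(θ * Real.log n))) - 1) +
        (a + 1) * Real.exp (-(2 * Real.log n)) * (n + 1)) +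
      Real.exp (2 * n) * (2 * Real.exp (-(3 * n)))) atTop (𝓝 0) := by
  have htwo := tendsto_mul_exp_neg_mul_log (one_lt_two)
  have hexp : ∀ {u : ℕ → ℝ}, Tendsto u atTop (𝓝 0) →
      Tendsto (fun n => Real.exp (u n) - 1) atTop (𝓝 0) := fun hu => by
    simpa using ((Real.continuous_exp.tendsto 0).comp hu).sub_const 1
  have hlog : Tendsto (fun n : ℕ => Real.exp (-(2 * Real.log n))) atTop (𝓝 0) :=
    Real.tendsto_exp_neg_atTop_nhds_zero.comp (tendsto_log_nat.const_mul_atTop two_pos)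
  have hneg : Tendsto (fun n : ℕ => Real.exp (-(n : ℝ))) atTop (𝓝 0) :=
    Real.tendsto_exp_neg_atTop_nhds_zero.comp tendsto_natCast_atTop_atTop
  have hdiv : Tendsto (fun n : ℕ => 4 / (b * n)) atTop (𝓝 0) :=
    (tendsto_natCast_atTop_atTop.const_mul_atTop hb).const_div_atTop 4
  have hsmall : Tendsto (fun n : ℕ => n * (2 * Real.exp (-(2 * Real.log n)))) atTop (𝓝 0) := by
    simpa [mul_left_comm] using htwo.const_mul 2
  have hmedium : Tendsto (fun n : ℕ => (a + 1) * Real.exp (-(2 * Real.log n)) * (n + 1)) atTop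
      (𝓝 0) := by
    simpa using ((htwo.add hlog).const_mul (a + 1)).congr fun n => by ring
  have hlarge :
      Tendsto (fun n : ℕ => Real.exp (2 * n) * (2 * Real.exp (-(3 * n)))) atTop (𝓝 0) := by
    refine (mul_zero (2 : ℝ) ▸ hneg.const_mul 2).congr fun n => ?_
    rw [mul_left_comm, ← Real.exp_add]
    ring_nf
  simpa using (hdiv.add ((((hexp hsmall).const_mul a).add
    (hexp (tendsto_mul_exp_neg_mul_log hθ))).add hmedium)).add hlarge

theorem tendsto_prob_not_connected {r : ℕ} [NeZero r] {μ : Fin r → ℝ} {Θ : Scaling r}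
    {μ₀ c₁ c₂ : ℝ} (hμ₀ : 0 < μ₀) (hμ : ∀ i, μ₀ ≤ μ i)
    (hadm : ∀ᶠ n in atTop, Admissible μ (Θ.K n) (Θ.P n))
    (hlo : ∀ᶠ n : ℕ in atTop, c₁ * (Real.log n / n) ≤ Θ.meanEdge μ n 0)
    (hhi : ∀ᶠ n : ℕ in atTop, Θ.meanEdge μ n 0 ≤ c₂ * (Real.log n / n))
    (hK : Tendsto (fun n => Θ.K n 0) atTop atTop) (hc₁ : 1 < c₁) :
    Tendsto (fun n => Θ.prob μ n fun G => ¬ G.Connected) atTop (𝓝 0) := by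
  obtain ⟨θ, hθ, hsmall⟩ := exists_eventually_small_cut_le hμ₀ hμ hadm hlo hhi hK hc₁
  obtain ⟨η, hη, hmedium⟩ := exists_eventually_medium_cut_le hμ₀ hμ hadm hlo hhi hK hc₁
  refine squeeze_zero' (.of_forall fun n => measureReal_nonneg) ?_ (tendsto_cut_bound r hθ hμ₀)
  filter_upwards [hsmall, hmedium, eventually_large_cut_le hμ₀ hμ hadm hlo hK hc₁ hη, hadm,
    eventually_gt_atTop 0] with n hsmall hmedium hlarge h hn
  obtain ⟨j, hj⟩ := h.exists_edgeProb_le (α := Θ.α n)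
  refine (h.measureReal_not_connected_le hn (hμ₀.trans_le (hμ j)) η).trans
    (add_le_add (add_le_add ?_ ?_) ?_)
  · gcongr
    exact hμ j
  · refine sum_small_le r.cast_nonneg (by positivity) (by positivity) (by positivity)
      fun S _ hSη => ?_
    rcases le_total (S.card : ℝ) (n * Real.exp (-(Real.log n / 32))) with hS | hS
    · exact (hsmall S hS).trans (le_add_of_nonneg_right (by positivity))
    · exact (hmedium S hS hSη).trans (le_add_of_nonneg_left (by positivity))
  · refine sum_pairs_le (by positivity) fun A hA => ?_
    obtain ⟨hdisj, hA₁, hA₂⟩ := (Finset.mem_filter.1 hA).2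
    exact hlarge j hj A.1 A.2 hdisj hA₁ hA₂

/-! ### Isolated nodes below the threshold -/

section SecondMoment

variable {Ω ι : Type*} [MeasurableSpace Ω] {M : Measure Ω} [Fintype ι] {I : ι → Set Ω} {a b : ℝ}

theorem integral_sq_sum_indicator_le [IsFiniteMeasure M] (hI : ∀ v, MeasurableSet (I v))
    (hb : 0 ≤ b) (hone : ∀ v, M.real (I v) = a) (htwo : ∀ u v, u ≠ v → M.real (I u ∩ I v) ≤ b) :
    ∫ ω, (∑ v, (I v).indicator (1 : Ω → ℝ) ω) ^ 2 ∂M ≤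
      Fintype.card ι * a + Fintype.card ι ^ 2 * b := by
  classical
  have hint : ∀ u v, Integrable ((I u ∩ I v).indicator (1 : Ω → ℝ)) M := fun u v =>
    (integrable_const (1 : ℝ)).indicator ((hI u).inter (hI v))
  calc _ = ∫ ω, ∑ u, ∑ v, (I u ∩ I v).indicator (1 : Ω → ℝ) ω ∂M := by
        simp_rw [sq, Finset.sum_mul_sum, Set.inter_indicator_one, Pi.mul_apply]
    _ = ∑ u, ∑ v, M.real (I u ∩ I v) := by
        rw [integral_finsetSum _ fun u _ => integrable_finsetSum _ fun v _ => hint u v]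
        simp_rw [integral_finsetSum _ fun v _ => hint _ v,
          integral_indicator_one ((hI _).inter (hI _))]
    _ ≤ ∑ u, ∑ v, ((if u = v then a else 0) + b) := by
        gcongr with u _ v _
        split_ifs with huv
        · subst huv
          simpa [hone] using hb
        · simpa using htwo u v huv
    _ = _ := by
        simp only [Finset.sum_add_distrib, Finset.sum_ite_eq, Finset.mem_univ, if_true,
          Finset.sum_const, Finset.card_univ, nsmul_eq_mul]
        ring

theorem measureReal_iInter_compl_le [IsProbabilityMeasure M] [Nonempty ι]
    (hI : ∀ v, MeasurableSet (I v)) (ha : 0 < a) (hb : 0 ≤ b) (hone : ∀ v, M.real (I v) = a)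
    (htwo : ∀ u v, u ≠ v → M.real (I u ∩ I v) ≤ b) :
    M.real (⋂ v, (I v)ᶜ) ≤ 1 / (Fintype.card ι * a) + (b / a ^ 2 - 1) := by
  set Z : Ω → ℝ := fun ω => ∑ v, (I v).indicator 1 ω
  set N := (Fintype.card ι : ℝ)
  have hN : 0 < N := by
    simp only [N]
    exact_mod_cast Fintype.card_pos
  have hZ : MemLp Z 2 M := memLp_finsetSum _ fun v _ =>
    memLp_indicator_const 2 (hI v) (1 : ℝ) (.inr (measure_ne_top M _))
  have hmean : ∫ ω, Z ω ∂M = N * a := by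
    have hint : ∀ v ∈ Finset.univ, Integrable ((I v).indicator (1 : Ω → ℝ)) M := fun v _ =>
      (integrable_const (1 : ℝ)).indicator (hI v)
    simp only [Z]
    rw [integral_finsetSum _ hint]
    simp_rw [integral_indicator_one (hI _), hone]
    simp [N]
  have hvar : Var[Z; M] ≤ N * a + N ^ 2 * b - (N * a) ^ 2 := by
    rw [variance_eq_sub hZ, hmean]
    exact sub_le_sub_right (integral_sq_sum_indicator_le hI hb hone htwo) _
  have hdev : ⋂ v, (I v)ᶜ ⊆ {ω | N * a ≤ |Z ω - ∫ ω, Z ω ∂M|} := fun ω hω => by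
    have hZω : Z ω = 0 := Finset.sum_eq_zero fun v _ =>
      Set.indicator_of_notMem (Set.mem_iInter.1 hω v) _
    simp only [Set.mem_ofPred_eq, hZω, hmean, zero_sub, abs_neg]
    exact le_abs_self _
  calc M.real (⋂ v, (I v)ᶜ) ≤ Var[Z; M] / (N * a) ^ 2 :=
        (measureReal_mono hdev).trans <| ENNReal.toReal_le_of_le_ofReal
          (div_nonneg (variance_nonneg _ _) (sq_nonneg _))
          (meas_ge_le_variance_div_sq hZ (by positivity))
    _ ≤ (N * a + N ^ 2 * b - (N * a) ^ 2) / (N * a) ^ 2 := by gcongr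
    _ = 1 / (N * a) + (b / a ^ 2 - 1) := by field_simp; ring

end SecondMoment

section Numeric

theorem exp_le_one_add_mul_exp {x c : ℝ} (hx : 0 ≤ x) (hxc : x ≤ c) :
    Real.exp x ≤ 1 + x * Real.exp c := by
  have hle : Real.exp x * (1 - x) ≤ 1 := by
    calc Real.exp x * (1 - x) ≤ Real.exp x * Real.exp (-x) := by
          gcongr
          exact Real.one_sub_le_exp_neg x
      _ = 1 := by rw [← Real.exp_add, add_neg_cancel, Real.exp_zero]
  have hmono : x * Real.exp x ≤ x * Real.exp c := by gcongr
  linarith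

theorem one_sub_two_mul_add_pow_le {Λ η : ℝ} (hΛ : Λ < 1) (hη0 : 0 ≤ η) (hηΛ : η ≤ Λ)
    (hpos : 0 ≤ 1 - 2 * Λ + η) {m n : ℕ} (hmn : m ≤ n) :
    (1 - 2 * Λ + η) ^ m ≤
      ((1 - Λ) ^ 2) ^ m * (1 + n * η / (1 - Λ) ^ 2 * Real.exp (n * Λ / (1 - Λ) ^ 2)) := by
  have : 0 < 1 - Λ := sub_pos.2 hΛ
  set y := η / (1 - Λ) ^ 2 with hy
  have : 0 ≤ y := by positivity
  have hbase : 1 - 2 * Λ + η ≤ (1 - Λ) ^ 2 * Real.exp y := by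
    calc 1 - 2 * Λ + η ≤ (1 - Λ) ^ 2 * (y + 1) := by
          rw [mul_add, hy, mul_div_cancel₀ _ (by positivity)]
          nlinarith [sq_nonneg Λ]
      _ ≤ (1 - Λ) ^ 2 * Real.exp y := by
          gcongr
          exact Real.add_one_le_exp y
  calc (1 - 2 * Λ + η) ^ m ≤ ((1 - Λ) ^ 2 * Real.exp y) ^ m := pow_le_pow_left₀ hpos hbase m
    _ = ((1 - Λ) ^ 2) ^ m * Real.exp (m * y) := by rw [mul_pow, Real.exp_nat_mul]
    _ ≤ ((1 - Λ) ^ 2) ^ m * Real.exp (n * η / (1 - Λ) ^ 2) := by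
        rw [mul_div_assoc]
        gcongr
    _ ≤ _ := by
        gcongr
        exact exp_le_one_add_mul_exp (by positivity) (by gcongr)

theorem exp_neg_mul_div_sq_le_one_sub_pow {Λ : ℝ} (h0 : 0 ≤ Λ) (h1 : Λ < 1) {m n : ℕ}
    (hmn : m ≤ n) : Real.exp (-(n * Λ / (1 - Λ) ^ 2)) ≤ (1 - Λ) ^ m := by
  have hpos : 0 < 1 - Λ := sub_pos.2 h1
  have hbase : Real.exp (-(Λ / (1 - Λ) ^ 2)) ≤ 1 - Λ := by
    rw [← Real.le_log_iff_exp_le hpos]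
    refine le_trans ?_ (Real.one_sub_inv_le_log_of_pos hpos)
    have hdiv : Λ / (1 - Λ) ≤ Λ / (1 - Λ) ^ 2 := by
      gcongr
      nlinarith
    have hinv : 1 - (1 - Λ)⁻¹ = -(Λ / (1 - Λ)) := by field_simp; ring
    linarith
  calc Real.exp (-(n * Λ / (1 - Λ) ^ 2)) = Real.exp (-(Λ / (1 - Λ) ^ 2)) ^ n := by
        rw [← Real.exp_nat_mul]
        ring_nf
    _ ≤ (1 - Λ) ^ n := pow_le_pow_left₀ (Real.exp_nonneg _) hbase n
    _ ≤ (1 - Λ) ^ m := pow_le_pow_of_le_one hpos.le (by linarith) hmn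

end Numeric

section Isolated

variable {n r P : ℕ} {μ : Fin r → ℝ} {K : Fin r → ℕ} {α : unitInterval} {ι : Type*} [Fintype ι]

theorem shareProb_comm {k l : ℕ} (h : k + l ≤ P) : shareProb P k l = shareProb P l k := by
  have hdouble : ∀ {k l : ℕ}, k + l ≤ P →
      ∫ S, ∫ T, hit S T ∂subsetLaw (Fin P) l ∂subsetLaw (Fin P) k = shareProb P k l := by
    intro k l h
    have := isProbabilityMeasure_subsetLaw (β := Fin P) (k := k)
      (by simpa using le_of_add_le_left h)
    have hinner : ∀ᵐ S ∂subsetLaw (Fin P) k,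
        ∫ T, hit S T ∂subsetLaw (Fin P) l = shareProb P k l := by
      filter_upwards [ae_card_eq_subsetLaw] with S hS
      simpa [hS] using integral_hit S (k := l) (by simpa [hS] using h)
    rw [integral_congr_ae hinner]
    simp
  rw [← hdouble h, ← hdouble (add_comm k l ▸ h), integral_integral_swap .of_finite]
  simp_rw [hit_comm]

theorem ae_card_eq_nodeLaw : ∀ᵐ a ∂nodeLaw μ K P, a.2.card = K a.1 := by
  rw [nodeLaw_eq_sum, ae_finsetSum_measure_iff]
  refine fun i _ => Measure.ae_smul_measure ?_ _
  rw [ae_map_iff (by fun_prop) .of_discrete]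
  exact ae_card_eq_subsetLaw

theorem ae_card_eq_pi_nodeLaw :
    ∀ᵐ y ∂Measure.pi fun _ : ι => nodeLaw μ K P, ∀ u, (y u).2.card = K (y u).1 :=
  eventually_all.2 fun u =>
    (Measure.tendsto_eval_ae_ae (μ := fun _ : ι => nodeLaw μ K P) (i := u)).eventually
      ae_card_eq_nodeLaw

/-- The probability that a random node shares a key with each of the nodes `y`. -/
def hitAll (μ : Fin r → ℝ) (K : Fin r → ℕ) (y : ι → Fin r × Finset (Fin P)) : ℝ :=
  ∑ i, μ i * ∫ S, ∏ u, hit (y u).2 S ∂subsetLaw (Fin P) (K i)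

theorem integral_pi_nodeLaw_class_eq_mul_prod (hμ : ∀ i, 0 ≤ μ i) (j : Fin r)
    (f : Finset (Fin P) → ℝ) :
    ∫ y : ι → Fin r × Finset (Fin P), (if ∀ u, (y u).1 = j then 1 else 0 : ℝ) * ∏ u, f (y u).2
        ∂Measure.pi (fun _ => nodeLaw μ K P) =
      (μ j * ∫ T, f T ∂subsetLaw (Fin P) (K j)) ^ Fintype.card ι := by
  have hnode : ∫ a, (if a.1 = j then f a.2 else 0) ∂nodeLaw μ K P =
      μ j * ∫ T, f T ∂subsetLaw (Fin P) (K j) := by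
    rw [integral_nodeLaw hμ, Fintype.sum_eq_single j fun i hi => by simp [hi]]
    simp
  rw [← hnode, ← integral_fintype_prod_eq_pow]
  refine integral_congr_ae (.of_forall fun y => ?_)
  dsimp only
  rw [Fintype.prod_ite_zero, ite_mul, one_mul, zero_mul]

namespace Admissible

variable [NeZero r] (h : Admissible μ K P)
include h

theorem integral_hit_subsetLaw (i : Fin r) {T : Finset (Fin P)} (hT : T.card = K 0) :
    ∫ S, hit T S ∂subsetLaw (Fin P) (K i) = shareProb P (K 0) (K i) := by
  simpa [hT] using integral_hit T (k := K i) (by simpa [hT] using h.add_le 0 i)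

theorem sum_mul_avoid_of_unique [Unique ι] {y : ι → Fin r × Finset (Fin P)}
    (hy : (y default).2.card = K 0) : ∑ i, μ i * avoid α (K i) y = 1 - edgeProb μ K P α := by
  have havoid : ∀ i, avoid α (K i) y = 1 - α * shareProb P (K 0) (K i) := fun i => by
    have := h.isProbabilityMeasure_subsetLaw i
    simp_rw [avoid, Fintype.prod_unique, coe_miss]
    rw [integral_sub .of_finite .of_finite, integral_const_mul, h.integral_hit_subsetLaw i hy]
    simp
  simp_rw [havoid, edgeProb, mul_sub, Finset.sum_sub_distrib, Finset.mul_sum, mul_one, h.μ_sum,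
    mul_left_comm (α : ℝ)]

theorem sum_mul_avoid_of_card_eq_two (hι : Fintype.card ι = 2) {y : ι → Fin r × Finset (Fin P)}
    (hy : ∀ u, (y u).2.card = K 0) :
    ∑ i, μ i * avoid α (K i) y = 1 - 2 * edgeProb μ K P α + (α : ℝ) ^ 2 * hitAll μ K y := by
  classical
  obtain ⟨a, b, hab, huniv⟩ := Finset.card_eq_two.1 hι
  have havoid : ∀ i, avoid α (K i) y = 1 - 2 * (α * shareProb P (K 0) (K i)) +
      (α : ℝ) ^ 2 * ∫ S, ∏ u, hit (y u).2 S ∂subsetLaw (Fin P) (K i) := fun i => by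
    have := h.isProbabilityMeasure_subsetLaw i
    have hexpand : ∀ S, ∏ u, (miss α (y u).2 S : ℝ) =
        1 - α * hit (y a).2 S - α * hit (y b).2 S + (α : ℝ) ^ 2 * ∏ u, hit (y u).2 S := fun S => by
      simp_rw [coe_miss, huniv, Finset.prod_pair hab]
      ring
    simp_rw [avoid, hexpand]
    rw [integral_add .of_finite .of_finite, integral_sub .of_finite .of_finite,
      integral_sub .of_finite .of_finite, integral_const_mul, integral_const_mul,
      integral_const_mul, h.integral_hit_subsetLaw i (hy a), h.integral_hit_subsetLaw i (hy b)]
    simp only [integral_const, probReal_univ, smul_eq_mul, mul_one]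
    ring
  calc ∑ i, μ i * avoid α (K i) y = ∑ i, (μ i - 2 * (α * (μ i * shareProb P (K 0) (K i))) +
        (α : ℝ) ^ 2 * (μ i * ∫ S, ∏ u, hit (y u).2 S ∂subsetLaw (Fin P) (K i))) :=
        Finset.sum_congr rfl fun i _ => by rw [havoid]; ring
    _ = _ := by
        rw [Finset.sum_add_distrib, Finset.sum_sub_distrib, h.μ_sum, ← Finset.mul_sum,
          ← Finset.mul_sum, ← Finset.mul_sum, edgeProb, hitAll]

theorem hitAll_nonneg (y : ι → Fin r × Finset (Fin P)) : 0 ≤ hitAll μ K y :=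
  Finset.sum_nonneg fun i _ => mul_nonneg (h.μ_nonneg i) <|
    integral_nonneg fun _ => Finset.prod_nonneg fun _ _ => hit_nonneg _ _

theorem sq_mul_hitAll_le_edgeProb {y : ι → Fin r × Finset (Fin P)} {u : ι}
    (hu : (y u).2.card = K 0) : (α : ℝ) ^ 2 * hitAll μ K y ≤ edgeProb μ K P α := by
  classical
  have hhit : hitAll μ K y ≤ ∑ i, μ i * shareProb P (K 0) (K i) := by
    refine Finset.sum_le_sum fun i _ => mul_le_mul_of_nonneg_left ?_ (h.μ_nonneg i)
    rw [← h.integral_hit_subsetLaw i hu]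
    refine integral_mono .of_finite .of_finite fun S => ?_
    dsimp only
    rw [← Finset.mul_prod_erase _ _ (Finset.mem_univ u)]
    exact mul_le_of_le_one_right (hit_nonneg _ _)
      (Finset.prod_le_one (fun _ _ => hit_nonneg _ _) fun _ _ => hit_le_one _ _)
  calc (α : ℝ) ^ 2 * hitAll μ K y ≤ α * hitAll μ K y :=
        mul_le_mul_of_nonneg_right (pow_le_of_le_one α.2.1 α.2.2 two_ne_zero) (h.hitAll_nonneg y)
    _ ≤ edgeProb μ K P α := mul_le_mul_of_nonneg_left hhit α.2.1

theorem integral_class_zero :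
    ∫ y : ι → Fin r × Finset (Fin P), (if ∀ u, (y u).1 = 0 then 1 else 0 : ℝ)
        ∂Measure.pi (fun _ => nodeLaw μ K P) = μ 0 ^ Fintype.card ι := by
  have := h.isProbabilityMeasure_nodeLaw
  have := h.isProbabilityMeasure_subsetLaw 0
  simpa using integral_pi_nodeLaw_class_eq_mul_prod (ι := ι) (K := K) (P := P) h.μ_nonneg 0
    fun _ => 1

theorem integral_class_zero_mul_hitAll :
    ∫ y : ι → Fin r × Finset (Fin P), (if ∀ u, (y u).1 = 0 then 1 else 0) * hitAll μ K y
        ∂Measure.pi (fun _ => nodeLaw μ K P) =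
      ∑ i, μ i * (μ 0 * shareProb P (K 0) (K i)) ^ Fintype.card ι := by
  have := h.isProbabilityMeasure_nodeLaw
  have hone : ∀ i, ∀ᵐ S ∂subsetLaw (Fin P) (K i),
      ∫ y : ι → Fin r × Finset (Fin P), (if ∀ u, (y u).1 = 0 then 1 else 0) *
        ∏ u, hit (y u).2 S ∂Measure.pi (fun _ => nodeLaw μ K P) =
      (μ 0 * shareProb P (K 0) (K i)) ^ Fintype.card ι := fun i => by
    filter_upwards [ae_card_eq_subsetLaw] with S hS
    have hshare := integral_hit S (k := K 0) (by simpa [hS] using h.add_le i 0)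
    rw [Fintype.card_fin, hS, shareProb_comm (h.add_le i 0)] at hshare
    rw [integral_pi_nodeLaw_class_eq_mul_prod h.μ_nonneg 0 fun T => hit T S]
    simp_rw [hit_comm _ S, hshare]
  simp_rw [hitAll, Finset.mul_sum, mul_left_comm _ (μ _)]
  rw [integral_finsetSum _ fun i _ => .of_finite]
  refine Finset.sum_congr rfl fun i _ => ?_
  have := h.isProbabilityMeasure_subsetLaw i
  simp_rw [integral_const_mul, ← integral_const_mul (ite _ _ _)]
  rw [integral_integral_swap .of_finite, integral_congr_ae (hone i)]
  simp

theorem sq_mul_sum_sq_shareProb_le {μ₀ : ℝ} (hμ₀ : 0 < μ₀) (hμ : ∀ i, μ₀ ≤ μ i) :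
    (α : ℝ) ^ 2 * ∑ i, μ i * shareProb P (K 0) (K i) ^ 2 ≤ edgeProb μ K P α ^ 2 / μ₀ := by
  calc (α : ℝ) ^ 2 * ∑ i, μ i * shareProb P (K 0) (K i) ^ 2 =
        ∑ i, α * (μ i * shareProb P (K 0) (K i)) * (α * shareProb P (K 0) (K i)) := by
        rw [Finset.mul_sum]
        exact Finset.sum_congr rfl fun i _ => by ring
    _ ≤ ∑ i, α * (μ i * shareProb P (K 0) (K i)) * (edgeProb μ K P α / μ₀) :=
        Finset.sum_le_sum fun i _ => mul_le_mul_of_nonneg_left (h.mul_shareProb_le hμ₀ hμ i)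
          (mul_nonneg α.2.1 (mul_nonneg (h.μ_nonneg i) (h.shareProb_nonneg i)))
    _ = edgeProb μ K P α ^ 2 / μ₀ := by
        rw [← Finset.sum_mul, ← Finset.mul_sum, ← edgeProb]
        ring

theorem measureReal_class_zero_and_noEdge_compl (S : Finset (Fin n)) :
    (modelMeasure n μ K P α).real {ω | (∀ u ∈ S, (ω.1 u).1 = 0) ∧ NoEdge (network ω) S Sᶜ} =
      ∫ y : S → Fin r × Finset (Fin P), (if ∀ u, (y u).1 = 0 then 1 else 0) *
        (∑ i, μ i * avoid α (K i) y) ^ (n - S.card) ∂Measure.pi fun _ => nodeLaw μ K P := by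
  have := h.measureReal_noEdge_and (α := α) (disjoint_compl_right (a := S))
    (fun y => ∀ u, (y u).1 = 0) fun _ => True
  simpa [Finset.card_compl] using this

theorem measureReal_class_zero_and_noEdge_singleton (v : Fin n) :
    (modelMeasure n μ K P α).real
        {ω | (∀ u ∈ ({v} : Finset (Fin n)), (ω.1 u).1 = 0) ∧ NoEdge (network ω) {v} {v}ᶜ} =
      μ 0 * (1 - edgeProb μ K P α) ^ (n - 1) := by
  rw [h.measureReal_class_zero_and_noEdge_compl]
  calc _ = ∫ y : ({v} : Finset (Fin n)) → Fin r × Finset (Fin P),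
        (if ∀ u, (y u).1 = 0 then 1 else 0) * (1 - edgeProb μ K P α) ^ (n - 1)
          ∂Measure.pi fun _ => nodeLaw μ K P := by
        refine integral_congr_ae ?_
        filter_upwards [ae_card_eq_pi_nodeLaw] with y hy
        by_cases hzero : ∀ u, (y u).1 = 0
        · rw [h.sum_mul_avoid_of_unique (by rw [hy, hzero]), Finset.card_singleton]
        · simp_rw [if_neg hzero, zero_mul]
    _ = _ := by
        rw [integral_mul_const, h.integral_class_zero, Fintype.card_coe, Finset.card_singleton,
          pow_one]

theorem integral_class_zero_mul_hitAll_le {μ₀ : ℝ} (hμ₀ : 0 < μ₀) (hμ : ∀ i, μ₀ ≤ μ i)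
    (hι : Fintype.card ι = 2) :
    (α : ℝ) ^ 2 * ∫ y : ι → Fin r × Finset (Fin P), (if ∀ u, (y u).1 = 0 then 1 else 0) *
        hitAll μ K y ∂Measure.pi (fun _ => nodeLaw μ K P) ≤
      μ 0 ^ 2 * (edgeProb μ K P α ^ 2 / μ₀) := by
  rw [h.integral_class_zero_mul_hitAll, hι]
  calc _ = μ 0 ^ 2 * ((α : ℝ) ^ 2 * ∑ i, μ i * shareProb P (K 0) (K i) ^ 2) := by
        simp_rw [Finset.mul_sum]
        exact Finset.sum_congr rfl fun i _ => by ring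
    _ ≤ _ := mul_le_mul_of_nonneg_left (h.sq_mul_sum_sq_shareProb_le hμ₀ hμ) (sq_nonneg _)

theorem sum_mul_avoid_pow_le_of_card_eq_two {Λ : ℝ} (hΛ : edgeProb μ K P α = Λ) (hlt : Λ < 1)
    (hι : Fintype.card ι = 2) {y : ι → Fin r × Finset (Fin P)} (hy : ∀ u, (y u).2.card = K 0) :
    (∑ i, μ i * avoid α (K i) y) ^ (n - 2) ≤ ((1 - Λ) ^ 2) ^ (n - 2) *
      (1 + n * ((α : ℝ) ^ 2 * hitAll μ K y) / (1 - Λ) ^ 2 * Real.exp (n * Λ / (1 - Λ) ^ 2)) := by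
  have hsum := h.sum_mul_avoid_of_card_eq_two (α := α) hι hy
  have : Nonempty ι := Fintype.card_pos_iff.1 (by omega)
  have hη := h.sq_mul_hitAll_le_edgeProb (α := α) (hy (Classical.arbitrary ι))
  rw [hΛ] at hsum hη
  have hpos : 0 ≤ ∑ i, μ i * avoid α (K i) y :=
    Finset.sum_nonneg fun i _ => mul_nonneg (h.μ_nonneg i) (avoid_nonneg _ _ _)
  rw [hsum] at hpos ⊢
  exact one_sub_two_mul_add_pow_le hlt (mul_nonneg (sq_nonneg _) (h.hitAll_nonneg y)) hη hpos
    (Nat.sub_le n 2)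

theorem measureReal_class_zero_and_noEdge_le {μ₀ Λ : ℝ} (hμ₀ : 0 < μ₀) (hμ : ∀ i, μ₀ ≤ μ i)
    (hΛ : edgeProb μ K P α = Λ) (hlt : Λ < 1) {S : Finset (Fin n)} (hS : S.card = 2) :
    (modelMeasure n μ K P α).real {ω | (∀ u ∈ S, (ω.1 u).1 = 0) ∧ NoEdge (network ω) S Sᶜ} ≤
      μ 0 ^ 2 * (((1 - Λ) ^ 2) ^ (n - 2) *
        (1 + n * (Λ ^ 2 / μ₀) / (1 - Λ) ^ 2 * Real.exp (n * Λ / (1 - Λ) ^ 2))) := by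
  have hcard : Fintype.card S = 2 := by rwa [Fintype.card_coe]
  set C := n / (1 - Λ) ^ 2 * Real.exp (n * Λ / (1 - Λ) ^ 2)
  have hpair := h.integral_class_zero_mul_hitAll_le (α := α) hμ₀ hμ hcard
  rw [h.measureReal_class_zero_and_noEdge_compl, hS]
  calc _ ≤ ∫ y : S → Fin r × Finset (Fin P), ((1 - Λ) ^ 2) ^ (n - 2) *
        ((if ∀ u, (y u).1 = 0 then 1 else 0) + C * ((α : ℝ) ^ 2 *
          ((if ∀ u, (y u).1 = 0 then 1 else 0) * hitAll μ K y)))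
        ∂Measure.pi fun _ => nodeLaw μ K P := by
        refine integral_mono_ae .of_finite .of_finite ?_
        filter_upwards [ae_card_eq_pi_nodeLaw] with y hy
        split_ifs with hzero
        · have := h.sum_mul_avoid_pow_le_of_card_eq_two (n := n) hΛ hlt hcard (y := y)
            fun u => by rw [hy, hzero]
          rw [one_mul, one_mul]
          exact this.trans_eq (by ring)
        · simp
    _ = ((1 - Λ) ^ 2) ^ (n - 2) * (μ 0 ^ 2 + C * ((α : ℝ) ^ 2 *
          ∫ y : S → Fin r × Finset (Fin P), (if ∀ u, (y u).1 = 0 then 1 else 0) * hitAll μ K y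
            ∂Measure.pi fun _ => nodeLaw μ K P)) := by
        rw [integral_const_mul, integral_add .of_finite .of_finite, h.integral_class_zero, hcard,
          integral_const_mul, integral_const_mul]
    _ ≤ ((1 - Λ) ^ 2) ^ (n - 2) * (μ 0 ^ 2 + C * (μ 0 ^ 2 * (Λ ^ 2 / μ₀))) := by
        rw [← hΛ]
        gcongr
    _ = _ := by ring

end Admissible

end Isolated

section ZeroLaw

variable {n r : ℕ} [NeZero r] {μ : Fin r → ℝ} {μ₀ c : ℝ}

theorem noEdge_pair {V : Type*} [Fintype V] [DecidableEq V] {G : SimpleGraph V} {u v : V}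
    (hu : NoEdge G {u} {u}ᶜ) (hv : NoEdge G {v} {v}ᶜ) : NoEdge G {u, v} {u, v}ᶜ := by
  simp only [NoEdge, Finset.mem_singleton, forall_eq, Finset.mem_compl, Finset.mem_insert,
    forall_eq_or_imp, not_or] at hu hv ⊢
  exact ⟨fun w hw => hu w hw.1, fun w hw => hv w hw.2⟩

theorem isIsolated_of_noEdge {V : Type*} [Fintype V] [DecidableEq V] {G : SimpleGraph V} {v : V}
    (hv : NoEdge G {v} {v}ᶜ) : G.IsIsolated v := fun w hadj =>
  hv v (Finset.mem_singleton_self v) w (by simpa using hadj.ne') hadj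

namespace Admissible

variable {P : ℕ} {K : Fin r → ℕ} {α : unitInterval} (h : Admissible μ K P)
include h

theorem measureReal_forall_not_isIsolated_le (hμ₀ : 0 < μ₀) (hμ : ∀ i, μ₀ ≤ μ i) (hn : 2 ≤ n)
    {Λ : ℝ} (hΛ : edgeProb μ K P α = Λ) (hlt : Λ < 1) :
    (modelMeasure n μ K P α).real {ω | ∀ v, ¬ (network ω).IsIsolated v} ≤
      1 / (n * (μ 0 * (1 - Λ) ^ (n - 1))) +
        ((1 + n * (Λ ^ 2 / μ₀) / (1 - Λ) ^ 2 * Real.exp (n * Λ / (1 - Λ) ^ 2)) / (1 - Λ) ^ 2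
          - 1) := by
  have := h.isProbabilityMeasure_modelMeasure (n := n) (α := α)
  have : Nonempty (Fin n) := ⟨⟨0, by omega⟩⟩
  have hpos : 0 < 1 - Λ := sub_pos.2 hlt
  have hμ0 : 0 < μ 0 := hμ₀.trans_le (hμ 0)
  have : 0 ≤ Λ := hΛ ▸ h.edgeProb_nonneg
  set I : Fin n → Set (Sample n r P) := fun v =>
    {ω | (∀ u ∈ ({v} : Finset (Fin n)), (ω.1 u).1 = 0) ∧ NoEdge (network ω) {v} {v}ᶜ}
  have hsub : {ω : Sample n r P | ∀ v, ¬ (network ω).IsIsolated v} ⊆ ⋂ v, (I v)ᶜ :=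
    fun ω hω => Set.mem_iInter.2 fun v hv => hω v (isIsolated_of_noEdge hv.2)
  have hpair : ∀ u v, u ≠ v → (modelMeasure n μ K P α).real (I u ∩ I v) ≤
      μ 0 ^ 2 * (((1 - Λ) ^ 2) ^ (n - 2) *
        (1 + n * (Λ ^ 2 / μ₀) / (1 - Λ) ^ 2 * Real.exp (n * Λ / (1 - Λ) ^ 2))) := fun u v huv =>
    have hboth : I u ∩ I v ⊆ {ω | (∀ w ∈ ({u, v} : Finset (Fin n)), (ω.1 w).1 = 0) ∧
        NoEdge (network ω) {u, v} {u, v}ᶜ} := fun ω ⟨hu, hv⟩ =>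
      ⟨by simpa using And.intro hu.1 hv.1, noEdge_pair hu.2 hv.2⟩
    (measureReal_mono hboth).trans
      (h.measureReal_class_zero_and_noEdge_le hμ₀ hμ hΛ hlt (Finset.card_pair huv))
  have hmoment := measureReal_iInter_compl_le (M := modelMeasure n μ K P α) (I := I)
    (a := μ 0 * (1 - Λ) ^ (n - 1)) (fun v => .of_discrete) (by positivity) (by positivity)
    (fun v => hΛ ▸ h.measureReal_class_zero_and_noEdge_singleton v) hpair
  refine (measureReal_mono hsub).trans (hmoment.trans_eq ?_)
  obtain ⟨m, rfl⟩ := Nat.exists_eq_add_of_le' hn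
  rw [Fintype.card_fin, Nat.add_sub_cancel, show m + 2 - 1 = m + 1 from rfl]
  congr 2
  field_simp
  rw [← pow_succ', pow_right_comm]

theorem measureReal_forall_not_isIsolated_le_of_mul_le (hμ₀ : 0 < μ₀) (hμ : ∀ i, μ₀ ≤ μ i)
    (hn : 2 ≤ n) {Λ : ℝ} (hΛ : edgeProb μ K P α = Λ) (hlt : Λ < 1)
    (hc : n * Λ / (1 - Λ) ^ 2 ≤ c * Real.log n) :
    (modelMeasure n μ K P α).real {ω | ∀ v, ¬ (network ω).IsIsolated v} ≤
      Real.exp (-((1 - c) * Real.log n)) / μ₀ +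
        ((1 + (n * Λ) ^ 2 * Real.exp (-((1 - c) * Real.log n)) / μ₀ / (1 - Λ) ^ 2) / (1 - Λ) ^ 2
          - 1) := by
  have : 0 < 1 - Λ := sub_pos.2 hlt
  have hμ0 : 0 < μ 0 := hμ₀.trans_le (hμ 0)
  have hΛ0 : 0 ≤ Λ := hΛ ▸ h.edgeProb_nonneg
  have hn0 : (0 : ℝ) < n := by exact_mod_cast (by omega : 0 < n)
  have hexp : Real.exp (n * Λ / (1 - Λ) ^ 2) ≤ n * Real.exp (-((1 - c) * Real.log n)) := by
    calc Real.exp (n * Λ / (1 - Λ) ^ 2) ≤ Real.exp (Real.log n + -((1 - c) * Real.log n)) :=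
          Real.exp_le_exp.2 (by linarith)
      _ = n * Real.exp (-((1 - c) * Real.log n)) := by rw [Real.exp_add, Real.exp_log hn0]
  refine (h.measureReal_forall_not_isIsolated_le hμ₀ hμ hn hΛ hlt).trans
    (add_le_add ?_ (sub_le_sub_right ?_ 1))
  · calc 1 / (n * (μ 0 * (1 - Λ) ^ (n - 1)))
        ≤ 1 / (n * (μ₀ * Real.exp (-(n * Λ / (1 - Λ) ^ 2)))) := by
          gcongr
          · exact hμ 0
          · exact exp_neg_mul_div_sq_le_one_sub_pow hΛ0 hlt (Nat.sub_le n 1)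
      _ = Real.exp (n * Λ / (1 - Λ) ^ 2) / (n * μ₀) := by
          rw [Real.exp_neg]
          field_simp
      _ ≤ n * Real.exp (-((1 - c) * Real.log n)) / (n * μ₀) := by gcongr
      _ = _ := mul_div_mul_left _ _ hn0.ne'
  · calc (1 + n * (Λ ^ 2 / μ₀) / (1 - Λ) ^ 2 * Real.exp (n * Λ / (1 - Λ) ^ 2)) / (1 - Λ) ^ 2
        ≤ (1 + n * (Λ ^ 2 / μ₀) / (1 - Λ) ^ 2 * (n * Real.exp (-((1 - c) * Real.log n)))) /
            (1 - Λ) ^ 2 := by gcongr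
      _ = _ := by ring

end Admissible

theorem tendsto_log_pow_mul_exp_neg (k : ℕ) {a : ℝ} (ha : 0 < a) :
    Tendsto (fun n : ℕ => Real.log n ^ k * Real.exp (-(a * Real.log n))) atTop (𝓝 0) := by
  have hpow := (tendsto_rpow_mul_exp_neg_mul_atTop_nhds_zero k a ha).comp tendsto_log_nat
  simpa only [Function.comp_def, Real.rpow_natCast, neg_mul] using hpow

theorem tendsto_isolated_bound {Λ : ℕ → ℝ} (hΛ : Tendsto Λ atTop (𝓝 0))
    (hmul : ∀ᶠ n : ℕ in atTop, 0 ≤ n * Λ n ∧ n * Λ n ≤ c * Real.log n) {a : ℝ} (ha : 0 < a) :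
    Tendsto (fun n : ℕ => Real.exp (-(a * Real.log n)) / μ₀ +
      ((1 + (n * Λ n) ^ 2 * Real.exp (-(a * Real.log n)) / μ₀ / (1 - Λ n) ^ 2) / (1 - Λ n) ^ 2
        - 1)) atTop (𝓝 0) := by
  have hX : Tendsto (fun n => (1 - Λ n) ^ 2) atTop (𝓝 1) := by
    simpa using (hΛ.const_sub 1).pow 2
  have hexp : Tendsto (fun n : ℕ => Real.exp (-(a * Real.log n))) atTop (𝓝 0) := by
    simpa only [pow_zero, one_mul] using tendsto_log_pow_mul_exp_neg 0 ha
  have hmulexp : Tendsto (fun n : ℕ => (n * Λ n) ^ 2 * Real.exp (-(a * Real.log n))) atTop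
      (𝓝 0) := by
    have hlog := (tendsto_log_pow_mul_exp_neg 2 ha).const_mul (c ^ 2)
    rw [mul_zero] at hlog
    refine squeeze_zero' (.of_forall fun n => by positivity) (hmul.mono fun n ⟨h0, hle⟩ => ?_) hlog
    rw [← mul_assoc, ← mul_pow]
    gcongr
  simpa using (hexp.div_const μ₀).add ((((((hmulexp.div_const μ₀).div hX one_ne_zero).const_add
    1).div hX one_ne_zero)).sub_const 1)

theorem tendsto_prob_forall_not_isIsolated_zero {Θ : Scaling r} (hμ₀ : 0 < μ₀) (hμ : ∀ i, μ₀ ≤ μ i)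
    (hadm : ∀ᶠ n in atTop, Admissible μ (Θ.K n) (Θ.P n))
    (hΛ : Tendsto (fun n => Θ.meanEdge μ n 0) atTop (𝓝 0))
    (hhi : ∀ᶠ n : ℕ in atTop, Θ.meanEdge μ n 0 ≤ c * (Real.log n / n)) (hc₀ : 0 < c) (hc₁ : c < 1) :
    Tendsto (fun n => Θ.prob μ n fun G => ∀ v, ¬ G.IsIsolated v) atTop (𝓝 0) := by
  obtain ⟨c', hcc', hc'⟩ := exists_between hc₁
  set Λ : ℕ → ℝ := fun n => Θ.meanEdge μ n 0
  have hX : ∀ᶠ n in atTop, c / c' < (1 - Λ n) ^ 2 :=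
    ((hΛ.const_sub 1).pow 2).eventually_const_lt
      (by simpa using (div_lt_one (hc₀.trans hcc')).2 hcc')
  have hmul : ∀ᶠ n : ℕ in atTop, 0 ≤ n * Λ n ∧ n * Λ n ≤ c * Real.log n := by
    filter_upwards [hadm, hhi, eventually_gt_atTop 0] with n h hhi hn
    have hn0 : (0 : ℝ) < n := by exact_mod_cast hn
    refine ⟨mul_nonneg hn0.le h.edgeProb_nonneg, ?_⟩
    calc n * Λ n ≤ n * (c * (Real.log n / n)) := by gcongr
      _ = c * Real.log n := by field_simp
  refine squeeze_zero' (.of_forall fun n => measureReal_nonneg) ?_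
    (tendsto_isolated_bound (μ₀ := μ₀) hΛ hmul (sub_pos.2 hc'))
  filter_upwards [hadm, hmul, hX, hΛ.eventually_lt_const one_pos, eventually_ge_atTop 2]
    with n h hmul hXn hlt hn
  refine h.measureReal_forall_not_isIsolated_le_of_mul_le hμ₀ hμ hn rfl hlt ?_
  have hpos : 0 < 1 - Λ n := sub_pos.2 hlt
  rw [div_lt_iff₀ (hc₀.trans hcc')] at hXn
  refine (div_le_iff₀ (by positivity)).2 (hmul.2.trans ?_)
  calc c * Real.log n ≤ (1 - Λ n) ^ 2 * c' * Real.log n := by gcongr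
    _ = c' * Real.log n * (1 - Λ n) ^ 2 := by ring

end ZeroLaw

/-! ### The threshold -/

section Threshold

variable {r : ℕ} [NeZero r] {μ : Fin r → ℝ} {Θ : Scaling r} {c : ℝ}

theorem Scaling.add_le (Θ : Scaling r) {n : ℕ} (hn : 2 ≤ n) (i j : Fin r) :
    Θ.K n i + Θ.K n j ≤ Θ.P n := by
  have hi := Θ.K_le n hn i
  have hj := Θ.K_le n hn j
  exact_mod_cast (by linarith : (Θ.K n i : ℝ) + Θ.K n j ≤ Θ.P n)

theorem Scaling.admissible (Θ : Scaling r) (hμ : ∀ i, 0 ≤ μ i) (hμ_sum : ∑ i, μ i = 1) {n : ℕ}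
    (hn : 2 ≤ n) : Admissible μ (Θ.K n) (Θ.P n) where
  μ_nonneg := hμ
  μ_sum := hμ_sum
  K_zero_pos := Θ.one_le_K n hn
  K_zero_le i := Θ.K_mono n hn (Fin.zero_le i)
  add_le := Θ.add_le hn

theorem tendsto_smallest_ring {σ : ℝ} (hσ : 0 < σ)
    (hP : ∀ n : ℕ, 1 ≤ n → σ * (n : ℝ) ≤ (Θ.P n : ℝ))
    (hp : (fun n : ℕ => 1 / ((n : ℝ) * (Θ.α n : ℝ))) =o[atTop] (fun n : ℕ => Θ.p n 0 0)) :
    Tendsto (fun n => Θ.K n 0) atTop atTop := by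
  refine tendsto_atTop.2 fun b => ?_
  have hε : 0 < σ / (b + 1 : ℝ) ^ 2 := by positivity
  filter_upwards [hp.bound hε, eventually_ge_atTop 2] with n hbound hn
  have hn0 : (0 : ℝ) < n := by exact_mod_cast (by omega : 0 < n)
  have hα := Θ.α_pos n
  have hadd := Θ.add_le hn 0 0
  have hshare : 0 ≤ Θ.p n 0 0 := shareProb_nonneg hadd
  rw [Real.norm_of_nonneg (by positivity), Real.norm_of_nonneg hshare] at hbound
  have hchain : (1 : ℝ) / n * 1 ≤ 1 / n * ((Θ.K n 0 : ℝ) ^ 2 / (b + 1 : ℝ) ^ 2) := by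
    calc (1 : ℝ) / n * 1 ≤ 1 / (n * Θ.α n) := by
          rw [mul_one]
          exact one_div_le_one_div_of_le (by positivity)
            (mul_le_of_le_one_right hn0.le (Θ.α_lt_one n).le)
      _ ≤ σ / (b + 1 : ℝ) ^ 2 * (Θ.K n 0 / Θ.P n * Θ.K n 0) :=
          hbound.trans (mul_le_mul_of_nonneg_left (shareProb_le hadd) hε.le)
      _ ≤ σ / (b + 1 : ℝ) ^ 2 * (Θ.K n 0 / (σ * n) * Θ.K n 0) := by
          gcongr
          exact hP n (by omega)
      _ = 1 / n * ((Θ.K n 0 : ℝ) ^ 2 / (b + 1 : ℝ) ^ 2) := by field_simp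
  have hsq := le_of_mul_le_mul_left hchain (by positivity)
  rw [one_le_div (by positivity)] at hsq
  have hle : (b + 1 : ℝ) ≤ Θ.K n 0 := le_of_sq_le_sq hsq (Nat.cast_nonneg _)
  exact (Nat.le_succ b).trans (by exact_mod_cast hle)

theorem eventually_log_div_pos : ∀ᶠ n : ℕ in atTop, 0 < Real.log n / n := by
  filter_upwards [eventually_ge_atTop 2] with n hn
  have hone : (1 : ℝ) < n := by exact_mod_cast hn
  exact div_pos (Real.log_pos hone) (by linarith)

theorem tendsto_div_of_isEquivalent_log_div {u : ℕ → ℝ} (hc : 0 < c)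
    (hu : u ~[atTop] fun n : ℕ => c * (Real.log n / n)) :
    Tendsto (fun n => u n / (Real.log n / n)) atTop (𝓝 c) := by
  have hne : ∀ᶠ n : ℕ in atTop, c * (Real.log n / n) ≠ 0 :=
    eventually_log_div_pos.mono fun n hn => (mul_pos hc hn).ne'
  refine mul_one c ▸ (((isEquivalent_iff_tendsto_one hne).1 hu).const_mul c).congr fun n => ?_
  rw [Pi.div_apply, mul_div_assoc', mul_div_mul_left _ _ hc.ne']

theorem eventually_le_of_isEquivalent_log_div {u : ℕ → ℝ} (hc : 0 < c)
    (hu : u ~[atTop] fun n : ℕ => c * (Real.log n / n)) {c₂ : ℝ} (hc₂ : c < c₂) :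
    ∀ᶠ n : ℕ in atTop, u n ≤ c₂ * (Real.log n / n) := by
  filter_upwards [(tendsto_div_of_isEquivalent_log_div hc hu).eventually_le_const hc₂,
    eventually_log_div_pos] with n hle hpos
  exact (div_le_iff₀ hpos).1 hle

theorem eventually_ge_of_isEquivalent_log_div {u : ℕ → ℝ} (hc : 0 < c)
    (hu : u ~[atTop] fun n : ℕ => c * (Real.log n / n)) {c₁ : ℝ} (hc₁ : c₁ < c) :
    ∀ᶠ n : ℕ in atTop, c₁ * (Real.log n / n) ≤ u n := by
  filter_upwards [(tendsto_div_of_isEquivalent_log_div hc hu).eventually_const_le hc₁,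
    eventually_log_div_pos] with n hle hpos
  exact (le_div_iff₀ hpos).1 hle

theorem tendsto_zero_of_isEquivalent_log_div {u : ℕ → ℝ}
    (hu : u ~[atTop] fun n : ℕ => c * (Real.log n / n)) : Tendsto u atTop (𝓝 0) := by
  have hlog : Tendsto (fun n : ℕ => Real.log n / n) atTop (𝓝 0) :=
    Real.isLittleO_log_id_atTop.tendsto_div_nhds_zero.comp tendsto_natCast_atTop_atTop
  exact hu.symm.tendsto_nhds (by simpa using hlog.const_mul c)

theorem Admissible.prob_connected_le {n : ℕ} (h : Admissible μ (Θ.K n) (Θ.P n)) (hn : 2 ≤ n) :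
    Θ.prob μ n (fun G => G.Connected) ≤ Θ.prob μ n (fun G => ∀ v, ¬ G.IsIsolated v) := by
  have := h.isProbabilityMeasure_modelMeasure (n := n) (α := Θ.α n)
  have : Nontrivial (Fin n) := Fin.nontrivial_iff_two_le.2 hn
  exact measureReal_mono fun ω (hω : (network ω).Connected) v => hω.preconnected.not_isIsolated v

theorem Admissible.prob_connected_eq {n : ℕ} (h : Admissible μ (Θ.K n) (Θ.P n)) :
    Θ.prob μ n (fun G => G.Connected) = 1 - Θ.prob μ n (fun G => ¬ G.Connected) := by
  have := h.isProbabilityMeasure_modelMeasure (n := n) (α := Θ.α n)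
  have hcompl := probReal_compl_eq_one_sub (μ := modelMeasure n μ (Θ.K n) (Θ.P n) (Θ.α n))
    (s := {ω | (network ω).Connected}) .of_discrete
  exact (sub_eq_iff_eq_add'.2 (sub_eq_iff_eq_add.1 hcompl.symm)).symm

theorem tendsto_prob_connected_zero (hadm : ∀ᶠ n in atTop, Admissible μ (Θ.K n) (Θ.P n))
    (h : Tendsto (fun n => Θ.prob μ n fun G => ∀ v, ¬ G.IsIsolated v) atTop (𝓝 0)) :
    Tendsto (fun n => Θ.prob μ n fun G => G.Connected) atTop (𝓝 0) := by
  refine squeeze_zero' (.of_forall fun n => measureReal_nonneg) ?_ h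
  filter_upwards [hadm, eventually_ge_atTop 2] with n h hn using h.prob_connected_le hn

theorem tendsto_prob_connected_one (hadm : ∀ᶠ n in atTop, Admissible μ (Θ.K n) (Θ.P n))
    (h : Tendsto (fun n => Θ.prob μ n fun G => ¬ G.Connected) atTop (𝓝 0)) :
    Tendsto (fun n => Θ.prob μ n fun G => G.Connected) atTop (𝓝 1) :=
  (sub_zero (1 : ℝ) ▸ h.const_sub 1).congr' (hadm.mono fun _ h => h.prob_connected_eq.symm)

theorem tendsto_prob_forall_not_isIsolated_one
    (hadm : ∀ᶠ n in atTop, Admissible μ (Θ.K n) (Θ.P n))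
    (h : Tendsto (fun n => Θ.prob μ n fun G => G.Connected) atTop (𝓝 1)) :
    Tendsto (fun n => Θ.prob μ n fun G => ∀ v, ¬ G.IsIsolated v) atTop (𝓝 1) := by
  refine tendsto_of_tendsto_of_tendsto_of_le_of_le' h tendsto_const_nhds ?_ ?_
  · filter_upwards [hadm, eventually_ge_atTop 2] with n h hn using h.prob_connected_le hn
  · filter_upwards [hadm] with n h
    have := h.isProbabilityMeasure_modelMeasure (n := n) (α := Θ.α n)
    exact measureReal_le_one

end Threshold

end HeterogeneousKeyGraph

end

open HeterogeneousKeyGraph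

theorem theorem2_general (r : ℕ) [NeZero r] (μ : Fin r → ℝ) (hμ_pos : ∀ i, 0 < μ i)
    (hμ_sum : ∑ i, μ i = 1) (Θ : HeterogeneousKeyGraph.Scaling r) (c : ℝ) (hc : 0 < c)
    (hΛ : (fun n : ℕ => Θ.meanEdge μ n 0) ~[atTop] (fun n : ℕ => c * (Real.log n / n))) :
    (c < 1 →
      Tendsto (fun n : ℕ => Θ.prob μ n (fun G => G.Connected)) atTop (𝓝 0) ∧
      Tendsto (fun n : ℕ => Θ.prob μ n (fun G => ∀ v, ¬ G.IsIsolated v)) atTop (𝓝 0)) ∧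
    (1 < c → Tendsto (fun n : ℕ => Θ.K n 0) atTop atTop →
      Tendsto (fun n : ℕ => Θ.prob μ n (fun G => G.Connected)) atTop (𝓝 1) ∧
      Tendsto (fun n : ℕ => Θ.prob μ n (fun G => ∀ v, ¬ G.IsIsolated v)) atTop (𝓝 1)) := by
  obtain ⟨i₀, hi₀⟩ := Finite.exists_min μ
  have hadm : ∀ᶠ n in atTop, Admissible μ (Θ.K n) (Θ.P n) :=
    (eventually_ge_atTop 2).mono fun n hn => Θ.admissible (fun i => (hμ_pos i).le) hμ_sum hn
  refine ⟨fun hc₁ => ?_, fun hc₁ hK => ?_⟩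
  · obtain ⟨c₂, hcc₂, hc₂⟩ := exists_between hc₁
    have hisolated := tendsto_prob_forall_not_isIsolated_zero (hμ_pos i₀) hi₀ hadm
      (tendsto_zero_of_isEquivalent_log_div hΛ)
      (eventually_le_of_isEquivalent_log_div hc hΛ hcc₂) (hc.trans hcc₂) hc₂
    exact ⟨tendsto_prob_connected_zero hadm hisolated, hisolated⟩
  · obtain ⟨c₁, hlt₁, hc₁c⟩ := exists_between hc₁
    have hconn := tendsto_prob_connected_one hadm <| tendsto_prob_not_connected (hμ_pos i₀) hi₀ hadm
      (eventually_ge_of_isEquivalent_log_div hc hΛ hc₁c)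
      (eventually_le_of_isEquivalent_log_div hc hΛ (lt_add_one c)) hK hlt₁
    exact ⟨hconn, tendsto_prob_forall_not_isIsolated_one hadm hconn⟩

theorem theorem2 (r : ℕ) [NeZero r] (μ : Fin r → ℝ) (hμ_pos : ∀ i, 0 < μ i)
    (hμ_sum : ∑ i, μ i = 1) (Θ : HeterogeneousKeyGraph.Scaling r) (c : ℝ) (hc : 0 < c)
    (hΛ : (fun n : ℕ => Θ.meanEdge μ n 0) ~[atTop] (fun n : ℕ => c * (Real.log n / n)))
    (σ : ℝ) (hσ : 0 < σ) (hP : ∀ n : ℕ, 1 ≤ n → σ * (n : ℝ) ≤ (Θ.P n : ℝ))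
    (hp : (fun n : ℕ => 1 / ((n : ℝ) * (Θ.α n : ℝ))) =o[atTop] (fun n : ℕ => Θ.p n 0 0)) :
    (c < 1 →
      Tendsto (fun n : ℕ => Θ.prob μ n (fun G => G.Connected)) atTop (𝓝 0) ∧
      Tendsto (fun n : ℕ => Θ.prob μ n (fun G => ∀ v, ¬ G.IsIsolated v)) atTop (𝓝 0)) ∧
    (1 < c →
      Tendsto (fun n : ℕ => Θ.prob μ n (fun G => G.Connected)) atTop (𝓝 1) ∧
      Tendsto (fun n : ℕ => Θ.prob μ n (fun G => ∀ v, ¬ G.IsIsolated v)) atTop (𝓝 1)) :=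
  (theorem2_general r μ hμ_pos hμ_sum Θ c hc hΛ).imp_right fun hone hc₁ =>
    hone hc₁ (tendsto_smallest_ring hσ hP hp)
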